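/- Let $M$ be a connected oriented smooth surface and $\mathbf{X} : M \to \mathbb{E}^3$ a smooth non-flat minimal immersion into Euclidean $3$-space, with induced metric $g$, Gauss curvature $K$, second fundamental form $A$ and stereographically projected (orientation compatible) Gauss map $G=(\mathbf{N}^1+i\mathbf{N}^2)/(1-\mathbf{N}^3) : M \to \mathbb{C}\cup\{\infty\}$. Equip $M$ with the complex structure induced by $g$ and the orientation, and let $Q$ be the Hopf differential, i.e. the holomorphic quadratic differential with $\operatorname{Re} Q = A$. A point is umbilic if the two principal curvatures agree there; let $M'$ be the complement of the set of umbilic points. On $M'$ let $\nabla$ be the Levi-Civita connection of the flat metric $g_0=\sqrt{-K}\,g$. For a differential $s\,dz^{\ell}$ of degree $\ell$ write $(s\,dz^{\ell})'=\nabla^{1,0}(s\,dz^\ell)=(\partial_z s-\ell\gamma s)\,dz^{\ell+1}$, where $z$ is a local holomorphic coordinate and $\nabla_{\partial_z}\partial_z=\gamma\,\partial_z$. The entropy differentials $P_\ell$ ($\ell\geq 2$) on $M'$ are defined by $$P_2=\frac{G'''}{G'}-\frac32\left(\frac{G''}{G'}\right)^2,\qquad P_{\ell+1}=(P_\ell)',$$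 where at poles of $G$ the expression for $P_2$ is computed with $1/G$ in place of $G$. Suppose that $\mathbf{X}$ is of degree five, that is, $P_5$ vanishes identically on $M'$ or $P_5=\psi(P_2,P_3,P_4)$ on $M'$ for some non-zero complex polynomial $\psi$ which is weighted-homogeneous of degree $5$ with respect to the weights $(2,3,4)$ (it is not required that $5$ is the smallest integer for which such a relation holds). Suppose furthermore that $Q$ vanishes to order exactly $n\in\mathbb{N}$ at some umbilic point. Then $Q$ vanishes to order exactly $n$ at every umbilic point, and $$P_5+24\,\frac{(n+2)^2}{(3n+4)\,n}\,P_3P_2=0\qquad\text{on } M'.$$ -/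

import Mathlib

open scoped Manifold ContDiff RealInnerProductSpace

noncomputable section

namespace EntropySurface

/-- Euclidean three-space. -/
abbrev E3 : Type := EuclideanSpace ℝ (Fin 3)

/-! ### Classical surface theory of a parametrised patch

A patch is a map `Y` from (an open part of) the `(x, y)`-plane, written as `ℂ` with `z = x + i y`,
to Euclidean three-space. All quantities at `z` depend only on the germ of `Y` at `z`. -/

/-- The coordinate directions `∂ₓ = 1` and `∂_y = i` of the coordinate plane. -/
def dir : Fin 2 → ℂ := ![1, Complex.I]

/-- The partial derivatives `∂₀ = ∂ₓ` and `∂₁ = ∂_y` of a function on the coordinate plane. -/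
def pd {F : Type*} [NormedAddCommGroup F] [NormedSpace ℝ F] (i : Fin 2) (f : ℂ → F) (z : ℂ) : F :=
  fderiv ℝ f z (dir i)

/-- The vector product of Euclidean three-space. -/
def cross (v w : E3) : E3 := WithLp.toLp 2 (crossProduct (WithLp.ofLp v) (WithLp.ofLp w))

/-- The induced metric `g = dY · dY`, as the matrix `gᵢⱼ = ∂ᵢY · ∂ⱼY`. -/
def metric (Y : ℂ → E3) (z : ℂ) : Matrix (Fin 2) (Fin 2) ℝ :=
  Matrix.of fun i j => ⟪pd i Y z, pd j Y z⟫

/-- The unit normal `N = (∂ₓY × ∂_yY) / |∂ₓY × ∂_yY|`. -/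
def normal (Y : ℂ → E3) (z : ℂ) : E3 :=
  ‖cross (pd 0 Y z) (pd 1 Y z)‖⁻¹ • cross (pd 0 Y z) (pd 1 Y z)

/-- The second fundamental form `A = - dN · dY`, as the matrix `Aᵢⱼ = - ∂ᵢN · ∂ⱼY`. -/
def secondForm (Y : ℂ → E3) (z : ℂ) : Matrix (Fin 2) (Fin 2) ℝ :=
  Matrix.of fun i j => -⟪pd i (normal Y) z, pd j Y z⟫

/-- The matrix `g⁻¹ A` of the Weingarten shape operator `S`, where `A(V, W) = g(S V, W)`. -/
def shape (Y : ℂ → E3) (z : ℂ) : Matrix (Fin 2) (Fin 2) ℝ :=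
  (metric Y z)⁻¹ * secondForm Y z

/-- The Gauss curvature `K = κ₁ κ₂ = det S`. -/
def patchGaussCurvature (Y : ℂ → E3) (z : ℂ) : ℝ := (shape Y z).det

/-- The coefficient `q` of the Hopf differential `Q = q dz²`, the quadratic differential with
`Re Q = A` (for a minimal patch in a conformal coordinate): `q = A(∂ₓ, ∂ₓ) - i A(∂ₓ, ∂_y)`. -/
def hopf (Y : ℂ → E3) (z : ℂ) : ℂ :=
  (secondForm Y z 0 0 : ℂ) - Complex.I * (secondForm Y z 0 1 : ℂ)

/-! ### Connections and Schwarzian derivatives in a complex coordinate -/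

/-- The Wirtinger derivative `∂_z = (∂ₓ - i ∂_y) / 2`. -/
def dz (s : ℂ → ℂ) (z : ℂ) : ℂ := (pd 0 s z - Complex.I * pd 1 s z) / 2

/-- The Christoffel symbols `Γᵏᵢⱼ` of a metric `h = (hᵢⱼ)` on the coordinate plane. -/
def christoffel (h : ℂ → Matrix (Fin 2) (Fin 2) ℝ) (k i j : Fin 2) (z : ℂ) : ℝ :=
  (1 / 2) * ∑ l, (h z)⁻¹ k l *
    (pd i (fun w => h w j l) z + pd j (fun w => h w i l) z - pd l (fun w => h w i j) z)

/-- The function `γ = dz(∇_{∂_z} ∂_z)` of the Levi-Civita connection `∇` of `h`, extended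
complex-linearly: here `∂_z = ∑ᵢ aᵢ ∂ᵢ` with `a = (1/2, -i/2)` and `dz = ∑ₖ bₖ dxₖ` with
`b = (1, i)`. For `h` conformal, `∇_{∂_z} ∂_z = γ ∂_z`. -/
def connectionCoeff (h : ℂ → Matrix (Fin 2) (Fin 2) ℝ) (z : ℂ) : ℂ :=
  let a : Fin 2 → ℂ := ![1 / 2, -Complex.I / 2]
  let b : Fin 2 → ℂ := ![1, Complex.I]
  ∑ i, ∑ j, ∑ k, a i * a j * b k * (christoffel h k i j z : ℂ)

/-- The operator `∇^{1,0}` from differentials `s dz^ℓ` of degree `ℓ` to differentials of degree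
`ℓ + 1`, on coefficients: `s ↦ ∂_z s - ℓ γ s`. -/
def nabla (γ : ℂ → ℂ) (ℓ : ℕ) (s : ℂ → ℂ) (z : ℂ) : ℂ := dz s z - ℓ * γ z * s z

/-- The coefficient of the Schwarzian derivative `f'''/f' - (3/2) (f''/f')²` with respect to the
connection given by `γ`, where primes denote `∇^{1,0}`. -/
def schwarzian (γ : ℂ → ℂ) (f : ℂ → ℂ) (z : ℂ) : ℂ :=
  let f₁ := nabla γ 0 f
  let f₂ := nabla γ 1 f₁
  let f₃ := nabla γ 2 f₂
  f₃ z / f₁ z - (3 / 2) * (f₂ z / f₁ z) ^ 2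

/-! ### The entropy differentials of a patch -/

/-- The stereographically projected Gauss map `G = (N¹ + i N²) / (1 - N³)`, where it is finite. -/
def stereoGauss (Y : ℂ → E3) (z : ℂ) : ℂ :=
  ((normal Y z 0 : ℂ) + Complex.I * (normal Y z 1 : ℂ)) / (1 - (normal Y z 2 : ℂ))

/-- The reciprocal `1 / G = (N¹ - i N²) / (1 + N³)` of the stereographically projected Gauss map,
where it is finite. -/
def stereoGaussInv (Y : ℂ → E3) (z : ℂ) : ℂ :=
  ((normal Y z 0 : ℂ) - Complex.I * (normal Y z 1 : ℂ)) / (1 + (normal Y z 2 : ℂ))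

/-- The metric `g₀ = √(-K) g`, flat away from umbilic points when the patch is minimal. -/
def flatMetric (Y : ℂ → E3) (z : ℂ) : Matrix (Fin 2) (Fin 2) ℝ :=
  Real.sqrt (-patchGaussCurvature Y z) • metric Y z

open Classical in
/-- The coefficient `p_ℓ` of the entropy differential `P_ℓ = p_ℓ dz^ℓ`, `ℓ ≥ 2`, in a conformal
coordinate `z`. `P₂` is the Schwarzian derivative of the meromorphic function `G` with respect to
the Levi-Civita connection of `g₀` (computed from `1 / G` at the poles of `G`, which is the usual
extension of the Schwarzian derivative to meromorphic functions), and
`P_{ℓ+1} = ∇^{1,0} P_ℓ`. The values for `ℓ = 0, 1` are not used. -/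
def entropy (Y : ℂ → E3) : ℕ → ℂ → ℂ
  | 0 => 0
  | 1 => 0
  | 2 => fun z =>
      if normal Y z 2 = 1 then schwarzian (connectionCoeff (flatMetric Y)) (stereoGaussInv Y) z
      else schwarzian (connectionCoeff (flatMetric Y)) (stereoGauss Y) z
  | (ℓ + 3) => nabla (connectionCoeff (flatMetric Y)) (ℓ + 2) (entropy Y (ℓ + 2))

/-! ### Oriented surfaces and minimal immersions -/

section Surface

variable {M : Type*} [TopologicalSpace M] [ChartedSpace ℂ M]

/-- The given atlas is oriented: all coordinate changes have positive Jacobian determinant. -/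
class OrientedAtlas (M : Type*) [TopologicalSpace M] [ChartedSpace ℂ M] : Prop where
  det_pos : ∀ e ∈ atlas ℂ M, ∀ e' ∈ atlas ℂ M, ∀ p ∈ e.source ∩ e'.source,
    0 < (fderiv ℝ (e' ∘ e.symm) (e p)).det

/-- The shape operator of `X` at `p`, in the preferred chart at `p`. -/
def shapeAt (X : M → E3) (p : M) : Matrix (Fin 2) (Fin 2) ℝ :=
  shape (X ∘ (chartAt ℂ p).symm) (chartAt ℂ p p)

/-- The mean curvature `H = tr S / 2` of `X`. -/
def meanCurvature (X : M → E3) (p : M) : ℝ := (1 / 2) * (shapeAt X p).trace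

/-- The Gauss curvature `K = det S` of `X`. -/
def gaussCurvature (X : M → E3) (p : M) : ℝ := (shapeAt X p).det

/-- `p` is an umbilic point of `X`: the principal curvatures at `p` agree, that is, the
(diagonalisable) shape operator at `p` is a multiple of the identity. -/
def IsUmbilic (X : M → E3) (p : M) : Prop := ∃ κ : ℝ, shapeAt X p = κ • (1 : Matrix _ _ ℝ)

/-- `X` is a smooth minimal immersion. -/
structure IsMinimalImmersion (X : M → E3) : Prop where
  smooth : ContMDiff 𝓘(ℝ, ℂ) 𝓘(ℝ, E3) ∞ X
  immersion : ∀ p, Function.Injective (mfderiv 𝓘(ℝ, ℂ) 𝓘(ℝ, E3) X p)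
  minimal : ∀ p, meanCurvature X p = 0

/-- `X` is non-flat: its Gauss curvature does not vanish identically. -/
def NonFlat (X : M → E3) : Prop := ∃ p, gaussCurvature X p ≠ 0

/-- `e` is a local holomorphic coordinate for the complex structure on `M` induced by the
orientation and the metric of `X`: a smooth chart that is positively oriented and in which the
induced metric is conformal to the flat metric of the coordinate plane. -/
structure IsHolomorphicCoordinate (X : M → E3) (e : OpenPartialHomeomorph M ℂ) : Prop where
  smooth : e ∈ IsManifold.maximalAtlas 𝓘(ℝ, ℂ) ∞ M
  oriented : ∀ e' ∈ atlas ℂ M, ∀ p ∈ e'.source ∩ e.source,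
    0 < (fderiv ℝ (e ∘ e'.symm) (e' p)).det
  conformal : ∀ z ∈ e.target, ∃ c : ℝ, metric (X ∘ e.symm) z = c • (1 : Matrix _ _ ℝ)

/-- The Hopf differential of `X` vanishes to order exactly `n` at `p`. -/
def HopfVanishesToOrder (X : M → E3) (n : ℕ) (p : M) : Prop :=
  ∃ e : OpenPartialHomeomorph M ℂ, IsHolomorphicCoordinate X e ∧ p ∈ e.source ∧
    AnalyticAt ℂ (hopf (X ∘ e.symm)) (e p) ∧
    analyticOrderAt (hopf (X ∘ e.symm)) (e p) = n

/-- `X` satisfies a degree `n` relation: away from the umbilic points, `P_n` vanishes identically,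
or `P_n = ψ(P₂, …, P_{n-1})` for some nonzero polynomial `ψ` that is weighted-homogeneous of
degree `n` with respect to the weights `(2, …, n - 1)`. Minimality of `n` is not required, so this
holds in particular when `n` is the degree of `X`, the least integer with such a relation. -/
def HasDegree (X : M → E3) (n : ℕ) : Prop :=
  2 ≤ n ∧
    ((∀ e : OpenPartialHomeomorph M ℂ, IsHolomorphicCoordinate X e →
        ∀ z ∈ e.target, ¬ IsUmbilic X (e.symm z) → entropy (X ∘ e.symm) n z = 0) ∨
      ∃ ψ : MvPolynomial (Fin (n - 2)) ℂ, ψ ≠ 0 ∧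
        ψ.IsWeightedHomogeneous (fun i : Fin (n - 2) => (i : ℕ) + 2) n ∧
        ∀ e : OpenPartialHomeomorph M ℂ, IsHolomorphicCoordinate X e →
          ∀ z ∈ e.target, ¬ IsUmbilic X (e.symm z) →
            entropy (X ∘ e.symm) n z =
              MvPolynomial.eval
                (fun i : Fin (n - 2) => entropy (X ∘ e.symm) ((i : ℕ) + 2) z) ψ)

end Surface

end EntropySurface

end

/-! Work in a holomorphic coordinate $z$ centred at an umbilic point. There $Q=q\,dz^2$ with $q$
holomorphic and $g_0=|q|\,|dz|^2$, so the connection coefficient is $\gamma=q'/(2q)$: if $q$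
vanishes to order $n$, this is a simple pole with residue $n/2$. Where $G$ is finite, $q=-wG'$ with
$w$ holomorphic and nonvanishing, so $G'$ has a zero of order $n$; at a pole of $G$ the same
argument for $1/G$ shows that $G'$ has a pole of order $n+2$. Both cases give $P_2$ the same leading
term $b z^{-2}$, with $b=-n(3n+4)/8$. Applying $\nabla^{1,0}$ to a term $z^{-\ell}$ in degree $\ell$
multiplies its coefficient by $-\ell(n+2)/2$, so $P_3$ starts with $-(n+2)b z^{-3}$ and $P_5$ with
$-3(n+2)^3b z^{-5}$.

The only monomial of weight $5$ in weights $(2,3,4)$ is $P_2P_3$, so the degree hypothesis says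
$P_5=c\,P_3P_2$ with one constant $c$ on all of $M'$. Comparing coefficients of $z^{-5}$ at an
umbilic point of order $n$ gives $c=-24(n+2)^2/((3n+4)n)$. This expression is injective in $n\geq
1$, so all umbilic points have the same order.

These steps are `hasLeadingTerm_entropy`, `HasDegree.exists_coefficient`,
`IsMinimalPatch.relation_coefficient` and `relation_coefficient_injective`. They rest on the
Weierstrass factorisation (`pairHopf_eq`), the existence of isothermal coordinates
(`exists_isothermal`), and an identity-theorem argument showing that the orders are finite
(`exists_hopfVanishesToOrder`). -/

noncomputable section

namespace EntropySurface

open Filter Topology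

/-! ### Leading terms of meromorphic functions -/

/-- Near `p`, away from `p` itself, `f z = (z - p) ^ k * h z` with `h` analytic and `h p = a`. -/
def HasLeadingTerm (f : ℂ → ℂ) (p : ℂ) (k : ℤ) (a : ℂ) : Prop :=
  ∃ h : ℂ → ℂ, AnalyticAt ℂ h p ∧ h p = a ∧ ∀ᶠ z in 𝓝[≠] p, f z = (z - p) ^ k * h z

namespace HasLeadingTerm

variable {f g : ℂ → ℂ} {p a b : ℂ} {k l : ℤ}

theorem congr (hf : HasLeadingTerm f p k a) (h : g =ᶠ[𝓝[≠] p] f) : HasLeadingTerm g p k a := by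
  obtain ⟨F, hF, hFp, hfF⟩ := hf
  exact ⟨F, hF, hFp, h.trans hfF⟩

theorem mul (hf : HasLeadingTerm f p k a) (hg : HasLeadingTerm g p l b) :
    HasLeadingTerm (fun z => f z * g z) p (k + l) (a * b) := by
  obtain ⟨F, hF, hFp, hfF⟩ := hf
  obtain ⟨H, hH, hHp, hgH⟩ := hg
  refine ⟨fun z => F z * H z, hF.mul hH, by simp [hFp, hHp], ?_⟩
  filter_upwards [hfF, hgH, self_mem_nhdsWithin] with z h1 h2 hz
  rw [h1, h2, zpow_add₀ (sub_ne_zero.2 hz)]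
  ring

theorem inv (hf : HasLeadingTerm f p k a) (ha : a ≠ 0) :
    HasLeadingTerm (fun z => (f z)⁻¹) p (-k) a⁻¹ := by
  obtain ⟨F, hF, hFp, hfF⟩ := hf
  refine ⟨fun z => (F z)⁻¹, hF.inv (hFp ▸ ha), by simp [hFp], ?_⟩
  filter_upwards [hfF] with z h1
  rw [h1, mul_inv, zpow_neg]

theorem div (hf : HasLeadingTerm f p k a) (hg : HasLeadingTerm g p l b) (hb : b ≠ 0) :
    HasLeadingTerm (fun z => f z / g z) p (k - l) (a / b) := by
  simpa only [div_eq_mul_inv, sub_eq_add_neg] using hf.mul (hg.inv hb)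

/-- The coefficient of a leading term may be zero, so cancellation needs no separate case;
nonvanishing is assumed only where one divides or needs $f\ne 0$. -/
theorem sub (hf : HasLeadingTerm f p k a) (hg : HasLeadingTerm g p k b) :
    HasLeadingTerm (fun z => f z - g z) p k (a - b) := by
  obtain ⟨F, hF, hFp, hfF⟩ := hf
  obtain ⟨H, hH, hHp, hgH⟩ := hg
  refine ⟨fun z => F z - H z, hF.sub hH, by simp [hFp, hHp], ?_⟩
  filter_upwards [hfF, hgH] with z h1 h2
  rw [h1, h2, mul_sub]

theorem const_mul (c : ℂ) (hf : HasLeadingTerm f p k a) :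
    HasLeadingTerm (fun z => c * f z) p k (c * a) := by
  obtain ⟨F, hF, hFp, hfF⟩ := hf
  refine ⟨fun z => c * F z, analyticAt_const.mul hF, by simp [hFp], ?_⟩
  filter_upwards [hfF] with z h1
  rw [h1]; ring

theorem unique (hf : HasLeadingTerm f p k a) (hg : HasLeadingTerm f p k b) : a = b := by
  obtain ⟨F, hF, hFp, hfF⟩ := hf
  obtain ⟨H, hH, hHp, hgH⟩ := hg
  have h : F =ᶠ[𝓝[≠] p] H := by
    filter_upwards [hfF, hgH, self_mem_nhdsWithin] with z h1 h2 hz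
    exact mul_left_cancel₀ (zpow_ne_zero k (sub_ne_zero.2 hz)) (h1.symm.trans h2)
  have h1 : Tendsto F (𝓝[≠] p) (𝓝 a) := hFp ▸ hF.continuousAt.tendsto.mono_left nhdsWithin_le_nhds
  have h2 : Tendsto H (𝓝[≠] p) (𝓝 b) := hHp ▸ hH.continuousAt.tendsto.mono_left nhdsWithin_le_nhds
  exact tendsto_nhds_unique h1 (h2.congr' h.symm)

theorem eventually_ne_zero (hf : HasLeadingTerm f p k a) (ha : a ≠ 0) :
    ∀ᶠ z in 𝓝[≠] p, f z ≠ 0 := by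
  obtain ⟨F, hF, rfl, hfF⟩ := hf
  filter_upwards [hfF, self_mem_nhdsWithin,
    (hF.continuousAt.eventually_ne ha).filter_mono nhdsWithin_le_nhds] with z h1 hz h2
  rw [h1]
  exact mul_ne_zero (zpow_ne_zero k (sub_ne_zero.2 hz)) h2

theorem eventually_differentiableAt (hf : HasLeadingTerm f p k a) :
    ∀ᶠ z in 𝓝[≠] p, DifferentiableAt ℂ f z := by
  obtain ⟨F, hF, -, hfF⟩ := hf
  filter_upwards [eventually_eventually_nhdsWithin.2 hfF, self_mem_nhdsWithin,
    hF.eventually_analyticAt.filter_mono nhdsWithin_le_nhds] with z h1 hz h2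
  have hz' : (z : ℂ) ≠ p := hz
  have h3 : f =ᶠ[𝓝 z] fun w => (w - p) ^ k * F w := by
    rwa [isOpen_compl_singleton.nhdsWithin_eq hz] at h1
  refine (DifferentiableAt.mul ?_ h2.differentiableAt).congr_of_eventuallyEq h3
  exact (differentiableAt_zpow.2 (Or.inl (sub_ne_zero.2 hz'))).comp z
    (differentiableAt_id.sub_const p)

theorem deriv (hf : HasLeadingTerm f p k a) : HasLeadingTerm (deriv f) p (k - 1) (k * a) := by
  obtain ⟨F, hF, rfl, hfF⟩ := hf
  refine ⟨fun z => k * F z + (z - p) * _root_.deriv F z,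
    (analyticAt_const.mul hF).add ((analyticAt_id.sub analyticAt_const).mul hF.deriv),
    by simp, ?_⟩
  filter_upwards [eventually_eventually_nhdsWithin.2 hfF, self_mem_nhdsWithin,
    hF.eventually_analyticAt.filter_mono nhdsWithin_le_nhds] with z h1 hz h2
  have hz' : z - p ≠ 0 := sub_ne_zero.2 hz
  have h3 : f =ᶠ[𝓝 z] fun w => (w - p) ^ k * F w := by
    rwa [isOpen_compl_singleton.nhdsWithin_eq hz] at h1
  have h4 : HasDerivAt (fun w : ℂ => (w - p) ^ k) (k * (z - p) ^ (k - 1)) z := by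
    simpa using (hasDerivAt_zpow k (z - p) (Or.inl hz')).comp_sub_const z p
  rw [h3.deriv_eq, HasDerivAt.deriv (h4.fun_mul h2.differentiableAt.hasDerivAt)]
  have h5 : (z - p) ^ k = (z - p) ^ (k - 1) * (z - p) := by
    rw [← zpow_add_one₀ hz', sub_add_cancel]
  rw [h5]; ring

theorem of_analyticOrderAt {n : ℕ} (hf : AnalyticAt ℂ f p) (hn : analyticOrderAt f p = n) :
    ∃ c ≠ 0, HasLeadingTerm f p n c := by
  obtain ⟨F, hF, hne, h⟩ := (hf.analyticOrderAt_eq_natCast).1 hn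
  refine ⟨F p, hne, F, hF, rfl, ?_⟩
  filter_upwards [h.filter_mono nhdsWithin_le_nhds] with z hz
  simpa using hz

end HasLeadingTerm

/-! ### The covariant derivative of a meromorphic differential -/

theorem dz_eq_deriv {s : ℂ → ℂ} {z : ℂ} (hs : DifferentiableAt ℂ s z) : dz s z = deriv s z := by
  have h : fderiv ℝ s z = (fderiv ℂ s z).restrictScalars ℝ := hs.fderiv_restrictScalars ℝ
  have h1 : fderiv ℂ s z Complex.I = Complex.I * fderiv ℂ s z 1 := by
    simpa only [smul_eq_mul, mul_one] using (fderiv ℂ s z).map_smul Complex.I 1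
  simp only [dz, pd, dir, h, ContinuousLinearMap.coe_restrictScalars', Matrix.cons_val_zero,
    Matrix.cons_val_one, h1, ← fderiv_apply_one_eq_deriv]
  linear_combination -(1 / 2) * fderiv ℂ s z 1 * Complex.I_sq

theorem HasLeadingTerm.dz_eventuallyEq {f : ℂ → ℂ} {p a : ℂ} {k : ℤ}
    (hf : HasLeadingTerm f p k a) : dz f =ᶠ[𝓝[≠] p] _root_.deriv f :=
  hf.eventually_differentiableAt.mono fun _ h => dz_eq_deriv h

/-- Differentiation and multiplication by a connection with a simple pole both lower the exponent by
one, so their contributions $ka$ and $\ell c a$ combine. -/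
theorem hasLeadingTerm_nabla {f γ : ℂ → ℂ} {p a c : ℂ} {k : ℤ} (ℓ : ℕ)
    (hf : HasLeadingTerm f p k a) (hγ : HasLeadingTerm γ p (-1) c) :
    HasLeadingTerm (nabla γ ℓ f) p (k - 1) ((k - ℓ * c) * a) := by
  have h1 := hf.deriv.congr hf.dz_eventuallyEq
  have h2 := (hγ.mul hf).const_mul ℓ
  rw [neg_add_eq_sub] at h2
  have h3 := h1.sub h2
  convert h3 using 1
  · funext z
    simp only [nabla]
    ring
  · ring

/-- The leading term of the Schwarzian derivative with respect to a connection with a simple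
pole. -/
theorem hasLeadingTerm_schwarzian {f γ : ℂ → ℂ} {p b c : ℂ} {k : ℤ} (hb : b ≠ 0)
    (hf : HasLeadingTerm (dz f) p k b) (hγ : HasLeadingTerm γ p (-1) c) :
    HasLeadingTerm (schwarzian γ f) p (-2)
      ((k - c) * (k - 1 - 2 * c) - 3 / 2 * (k - c) ^ 2) := by
  -- In degree $0$ the connection term drops out. Since only the derivative of $f$ enters, the value
  -- of $f$ at $p$ is irrelevant.
  have h1 : HasLeadingTerm (nabla γ 0 f) p k b := by
    convert hf using 1
    funext z
    simp [nabla]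
  have h2 := hasLeadingTerm_nabla 1 h1 hγ
  have h3 := hasLeadingTerm_nabla 2 h2 hγ
  have h4 := h3.div h1 hb
  have h5 := h2.div h1 hb
  have h6 := (h5.mul h5).const_mul (3 / 2)
  rw [show k - 1 - 1 - k = -2 by ring] at h4
  rw [show k - 1 - k + (k - 1 - k) = -2 by ring] at h6
  convert h4.sub h6 using 1
  · funext z
    simp only [schwarzian, sq]
  · push_cast
    field_simp

/-! ### Vector algebra in Euclidean three-space -/

theorem inner_eq_sum (v w : E3) : ⟪v, w⟫ = v 0 * w 0 + v 1 * w 1 + v 2 * w 2 := by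
  simp [PiLp.inner_apply, Fin.sum_univ_three, mul_comm]

theorem cross_apply_zero (v w : E3) : cross v w 0 = v 1 * w 2 - v 2 * w 1 := by
  simp [cross, cross_apply]

theorem cross_apply_one (v w : E3) : cross v w 1 = v 2 * w 0 - v 0 * w 2 := by
  simp [cross, cross_apply]

theorem cross_apply_two (v w : E3) : cross v w 2 = v 0 * w 1 - v 1 * w 0 := by
  simp [cross, cross_apply]

theorem E3.ext_three {v w : E3} (h0 : v 0 = w 0) (h1 : v 1 = w 1) (h2 : v 2 = w 2) : v = w := by
  ext i
  fin_cases i <;> assumption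

theorem inner_cross_cross (u v w x : E3) :
    ⟪cross u v, cross w x⟫ = ⟪u, w⟫ * ⟪v, x⟫ - ⟪u, x⟫ * ⟪v, w⟫ := by
  simp only [inner_eq_sum, cross_apply_zero, cross_apply_one, cross_apply_two]
  ring

theorem inner_cross_rotate (u v w : E3) : ⟪cross u v, w⟫ = ⟪u, cross v w⟫ := by
  simp only [inner_eq_sum, cross_apply_zero, cross_apply_one, cross_apply_two]
  ring

theorem cross_anticomm (v w : E3) : cross v w = -cross w v := by
  apply E3.ext_three <;>
    simp only [PiLp.neg_apply, cross_apply_zero, cross_apply_one, cross_apply_two] <;> ring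

theorem inner_cross_self_left (v w : E3) : ⟪cross v w, v⟫ = 0 := by
  simp only [inner_eq_sum, cross_apply_zero, cross_apply_one, cross_apply_two]
  ring

theorem inner_cross_self_right (v w : E3) : ⟪cross v w, w⟫ = 0 := by
  simp only [inner_eq_sum, cross_apply_zero, cross_apply_one, cross_apply_two]
  ring

theorem cross_cross (u v w : E3) : cross (cross u v) w = ⟪u, w⟫ • v - ⟪v, w⟫ • u := by
  apply E3.ext_three <;>
    simp only [PiLp.sub_apply, PiLp.smul_apply, smul_eq_mul, inner_eq_sum, cross_apply_zero,
      cross_apply_one, cross_apply_two] <;> ring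

theorem cross_smul_left (c : ℝ) (v w : E3) : cross (c • v) w = c • cross v w := by
  simp [cross]

theorem cross_add_left (u v w : E3) : cross (u + v) w = cross u w + cross v w := by
  simp [cross]

theorem cross_smul_right (c : ℝ) (v w : E3) : cross v (c • w) = c • cross v w := by
  simp [cross]

theorem cross_add_right (u v w : E3) : cross u (v + w) = cross u v + cross u w := by
  simp [cross]

/-- A vector orthogonal to `v`, `w` and `v × w` vanishes when `v × w ≠ 0`. -/
theorem eq_zero_of_inner_eq_zero {v w x : E3} (h : cross v w ≠ 0) (hv : ⟪x, v⟫ = 0)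
    (hw : ⟪x, w⟫ = 0) (hvw : ⟪x, cross v w⟫ = 0) : x = 0 := by
  have h1 : cross (cross v w) x = 0 := by
    rw [cross_cross, real_inner_comm, hv, real_inner_comm, hw]; simp
  have h2 : ⟪cross v w, cross v w⟫ * ⟪x, x⟫ = 0 := by
    have := inner_cross_cross (cross v w) x (cross v w) x
    rw [h1, inner_zero_left, hvw] at this
    linarith
  rcases mul_eq_zero.1 h2 with h3 | h3
  · exact absurd (inner_self_eq_zero.1 h3) h
  · exact inner_self_eq_zero.1 h3

/-- The Gram determinant of three vectors. -/
theorem inner_cross_sq (n a w : E3) :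
    ⟪cross n a, w⟫ ^ 2 = ⟪n, n⟫ * ⟪a, a⟫ * ⟪w, w⟫ + 2 * ⟪n, a⟫ * ⟪a, w⟫ * ⟪n, w⟫
      - ⟪n, n⟫ * ⟪a, w⟫ ^ 2 - ⟪a, a⟫ * ⟪n, w⟫ ^ 2 - ⟪w, w⟫ * ⟪n, a⟫ ^ 2 := by
  simp only [inner_eq_sum, cross_apply_zero, cross_apply_one, cross_apply_two]
  ring

/-! ### Calculus of partial derivatives -/

section Calculus

variable {F : Type*} [NormedAddCommGroup F] [NormedSpace ℝ F] {U : Set ℂ} {z : ℂ}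

theorem pd_congr {f g : ℂ → F} (i : Fin 2) (h : f =ᶠ[𝓝 z] g) : pd i f z = pd i g z := by
  simp only [pd, h.fderiv_eq]

theorem contDiffOn_pd {f : ℂ → F} (hU : IsOpen U) (hf : ContDiffOn ℝ ∞ f U) (i : Fin 2) :
    ContDiffOn ℝ ∞ (pd i f) U :=
  (hf.fderiv_of_isOpen hU (by simp)).clm_apply contDiffOn_const

theorem pd_comm {f : ℂ → F} (hf : ContDiffAt ℝ 2 f z) (i j : Fin 2) :
    pd i (pd j f) z = pd j (pd i f) z := by
  have h1 : DifferentiableAt ℝ (fderiv ℝ f) z :=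
    (hf.fderiv_right (m := 1) (by norm_num)).differentiableAt (by norm_num)
  have h2 (i j : Fin 2) : pd i (pd j f) z = fderiv ℝ (fderiv ℝ f) z (dir i) (dir j) := by
    unfold pd
    rw [fderiv_clm_apply h1 (differentiableAt_const _)]
    simp
  rw [h2, h2]
  exact hf.isSymmSndFDerivAt (by simp) _ _

theorem pd_inner {V W : ℂ → E3} (hV : DifferentiableAt ℝ V z) (hW : DifferentiableAt ℝ W z)
    (i : Fin 2) : pd i (fun w => ⟪V w, W w⟫) z = ⟪pd i V z, W z⟫ + ⟪V z, pd i W z⟫ := by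
  simp only [pd, fderiv_inner_apply ℝ hV hW]
  ring

theorem pd_clm_comp {G : Type*} [NormedAddCommGroup G] [NormedSpace ℝ G] (L : F →L[ℝ] G)
    {f : ℂ → F} (hf : DifferentiableAt ℝ f z) (i : Fin 2) :
    pd i (fun w => L (f w)) z = L (pd i f z) := by
  have : HasFDerivAt (fun w => L (f w)) (L.comp (fderiv ℝ f z)) z :=
    L.hasFDerivAt.comp z hf.hasFDerivAt
  simp [pd, this.fderiv]

theorem pd_apply {V : ℂ → E3} (hV : DifferentiableAt ℝ V z) (i : Fin 2) (k : Fin 3) :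
    pd i (fun w => V w k) z = pd i V z k :=
  pd_clm_comp (EuclideanSpace.proj k : E3 →L[ℝ] ℝ) hV i

theorem pd_ofReal_apply {V : ℂ → E3} (hV : DifferentiableAt ℝ V z) (i : Fin 2) (k : Fin 3) :
    pd i (fun w => (V w k : ℂ)) z = pd i V z k := by
  rw [← pd_apply hV]
  exact pd_clm_comp Complex.ofRealCLM (f := fun w => V w k)
    ((EuclideanSpace.proj k : E3 →L[ℝ] ℝ).differentiableAt.comp z hV) i

/-- The vector product as a continuous bilinear map. -/
def crossL : E3 →L[ℝ] E3 →L[ℝ] E3 :=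
  LinearMap.toContinuousLinearMap
    ((LinearMap.toContinuousLinearMap : (E3 →ₗ[ℝ] E3) ≃ₗ[ℝ] (E3 →L[ℝ] E3)).toLinearMap ∘ₗ
      LinearMap.mk₂ ℝ cross cross_add_left cross_smul_left cross_add_right cross_smul_right)

@[simp] theorem crossL_apply (v w : E3) : crossL v w = cross v w := rfl

theorem contDiffOn_cross {V W : ℂ → E3} (hV : ContDiffOn ℝ ∞ V U) (hW : ContDiffOn ℝ ∞ W U) :
    ContDiffOn ℝ ∞ (fun w => cross (V w) (W w)) U :=
  ((crossL.contDiff.comp_contDiffOn hV).clm_apply hW)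

theorem pd_cross {V W : ℂ → E3} (hV : DifferentiableAt ℝ V z) (hW : DifferentiableAt ℝ W z)
    (i : Fin 2) :
    pd i (fun w => cross (V w) (W w)) z = cross (pd i V z) (W z) + cross (V z) (pd i W z) := by
  have h := (crossL.hasFDerivAt.comp z hV.hasFDerivAt).clm_apply hW.hasFDerivAt
  have h' : HasFDerivAt (fun w => cross (V w) (W w)) _ z := h
  simp [pd, h'.fderiv, add_comm]

end Calculus

/-! ### Minimal patches -/

/-- A smooth immersed minimal patch on an open set of the coordinate plane. -/
structure IsMinimalPatch (Y : ℂ → E3) (U : Set ℂ) : Prop where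
  isOpen : IsOpen U
  contDiffOn : ContDiffOn ℝ ∞ Y U
  cross_ne : ∀ z ∈ U, cross (pd 0 Y z) (pd 1 Y z) ≠ 0
  trace_eq : ∀ z ∈ U, (shape Y z).trace = 0

theorem contDiffOn_normal {Y : ℂ → E3} {U : Set ℂ} (hU : IsOpen U) (hY : ContDiffOn ℝ ∞ Y U)
    (hc : ∀ z ∈ U, cross (pd 0 Y z) (pd 1 Y z) ≠ 0) : ContDiffOn ℝ ∞ (normal Y) U := by
  have h := contDiffOn_cross (contDiffOn_pd hU hY 0) (contDiffOn_pd hU hY 1)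
  exact ((h.norm ℝ hc).inv fun z hz => norm_ne_zero_iff.2 (hc z hz)).smul h

theorem det_metric (Y : ℂ → E3) (z : ℂ) :
    (metric Y z).det = ⟪cross (pd 0 Y z) (pd 1 Y z), cross (pd 0 Y z) (pd 1 Y z)⟫ := by
  rw [inner_cross_cross, Matrix.det_fin_two]
  simp [metric]

theorem trace_shape (Y : ℂ → E3) (z : ℂ) :
    (shape Y z).trace = (metric Y z).det⁻¹ *
      (metric Y z 1 1 * secondForm Y z 0 0 - metric Y z 0 1 * secondForm Y z 1 0
        - metric Y z 1 0 * secondForm Y z 0 1 + metric Y z 0 0 * secondForm Y z 1 1) := by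
  simp only [shape, Matrix.inv_def, Ring.inverse_eq_inv', Matrix.adjugate_fin_two,
    Matrix.trace_fin_two, Matrix.smul_mul, Matrix.smul_apply, Matrix.mul_apply,
    Fin.sum_univ_two, Matrix.of_apply, Matrix.cons_val', Matrix.cons_val_zero,
    Matrix.cons_val_one, Matrix.cons_val_fin_one, smul_eq_mul]
  ring

theorem inner_normal_cross (Y : ℂ → E3) (z : ℂ) (v : E3)
    (h : ⟪v, normal Y z⟫ = 0) : ⟪v, cross (pd 0 Y z) (pd 1 Y z)⟫ = 0 := by
  by_cases h0 : cross (pd 0 Y z) (pd 1 Y z) = 0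
  · rw [h0, inner_zero_right]
  · rw [normal, inner_smul_right] at h
    exact (mul_eq_zero.1 h).resolve_left (inv_ne_zero (norm_ne_zero_iff.2 h0))

theorem inner_normal_pd (Y : ℂ → E3) (z : ℂ) (i : Fin 2) :
    ⟪normal Y z, pd i Y z⟫ = 0 := by
  rw [normal, inner_smul_left]
  fin_cases i
  · simp [inner_cross_self_left]
  · simp [inner_cross_self_right]

namespace IsMinimalPatch

variable {Y : ℂ → E3} {U : Set ℂ} {z : ℂ}

theorem contDiffOn_normal (h : IsMinimalPatch Y U) : ContDiffOn ℝ ∞ (normal Y) U :=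
  EntropySurface.contDiffOn_normal h.isOpen h.contDiffOn h.cross_ne

theorem differentiableAt (h : IsMinimalPatch Y U) (hz : z ∈ U) : DifferentiableAt ℝ Y z :=
  (h.contDiffOn.contDiffAt (h.isOpen.mem_nhds hz)).differentiableAt (by simp)

theorem differentiableAt_pd (h : IsMinimalPatch Y U) (hz : z ∈ U) (i : Fin 2) :
    DifferentiableAt ℝ (pd i Y) z :=
  ((contDiffOn_pd h.isOpen h.contDiffOn i).contDiffAt (h.isOpen.mem_nhds hz)).differentiableAt
    (by simp)

theorem differentiableAt_normal (h : IsMinimalPatch Y U) (hz : z ∈ U) :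
    DifferentiableAt ℝ (normal Y) z :=
  (h.contDiffOn_normal.contDiffAt (h.isOpen.mem_nhds hz)).differentiableAt (by simp)

theorem inner_normal_normal (h : IsMinimalPatch Y U) (hz : z ∈ U) :
    ⟪normal Y z, normal Y z⟫ = 1 := by
  have := norm_ne_zero_iff.2 (h.cross_ne z hz)
  rw [normal, inner_smul_left, inner_smul_right, real_inner_self_eq_norm_sq]
  simp only [conj_trivial]
  field_simp

theorem inner_normal_pd_normal (h : IsMinimalPatch Y U) (hz : z ∈ U) (i : Fin 2) :
    ⟪normal Y z, pd i (normal Y) z⟫ = 0 := by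
  have hd := h.differentiableAt_normal hz
  have h1 : (fun w => ⟪normal Y w, normal Y w⟫) =ᶠ[𝓝 z] fun _ => (1 : ℝ) := by
    filter_upwards [h.isOpen.mem_nhds hz] with w hw using h.inner_normal_normal hw
  have h2 := pd_inner hd hd i
  rw [pd_congr i h1, real_inner_comm] at h2
  simp only [pd, fderiv_fun_const, Pi.zero_apply, zero_apply] at h2 ⊢
  linarith

theorem inner_pd_normal_pd (h : IsMinimalPatch Y U) (hz : z ∈ U) (i j : Fin 2) :
    ⟪pd i (normal Y) z, pd j Y z⟫ = -⟪normal Y z, pd i (pd j Y) z⟫ := by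
  have h1 : (fun w => ⟪normal Y w, pd j Y w⟫) =ᶠ[𝓝 z] fun _ => (0 : ℝ) :=
    Eventually.of_forall fun w => inner_normal_pd Y w j
  have h2 := pd_inner (h.differentiableAt_normal hz) (h.differentiableAt_pd hz j) i
  rw [pd_congr i h1] at h2
  simp only [pd, fderiv_fun_const, Pi.zero_apply, zero_apply] at h2 ⊢
  linarith

theorem secondForm_symm (h : IsMinimalPatch Y U) (hz : z ∈ U) :
    ⟪pd 1 (normal Y) z, pd 0 Y z⟫ = ⟪pd 0 (normal Y) z, pd 1 Y z⟫ := by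
  rw [h.inner_pd_normal_pd hz, h.inner_pd_normal_pd hz, pd_comm]
  exact (h.contDiffOn.contDiffAt (h.isOpen.mem_nhds hz)).of_le (by norm_cast)

theorem det_metric_ne_zero (h : IsMinimalPatch Y U) (hz : z ∈ U) : (metric Y z).det ≠ 0 := by
  rw [det_metric]
  exact inner_self_ne_zero.2 (h.cross_ne z hz)

/-- The form `N × dY` is closed. -/
theorem cross_pd_normal (h : IsMinimalPatch Y U) (hz : z ∈ U) :
    cross (pd 0 (normal Y) z) (pd 1 Y z) = cross (pd 1 (normal Y) z) (pd 0 Y z) := by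
  have hN (i : Fin 2) : ⟪pd i (normal Y) z, cross (pd 0 Y z) (pd 1 Y z)⟫ = 0 := by
    apply inner_normal_cross
    rw [real_inner_comm, h.inner_normal_pd_normal hz]
  have ht := h.trace_eq z hz
  rw [trace_shape] at ht
  replace ht := (mul_eq_zero.1 ht).resolve_left (inv_ne_zero (h.det_metric_ne_zero hz))
  simp only [metric, secondForm, Matrix.of_apply] at ht
  rw [← sub_eq_zero]
  apply eq_zero_of_inner_eq_zero (h.cross_ne z hz)
  · rw [inner_sub_left, inner_cross_self_right, inner_cross_rotate, cross_anticomm, inner_neg_right,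
      hN]
    simp
  · rw [inner_sub_left, inner_cross_self_right, inner_cross_rotate, hN]
    simp
  -- The tangential components vanish because $dN$ is tangential; the normal one is the trace of the
  -- shape operator, up to a nonzero factor.
  · rw [inner_sub_left, inner_cross_cross, inner_cross_cross]
    linear_combination -ht

end IsMinimalPatch

/-! ### Weierstrass data of a conformal minimal patch -/

/-- A conformal harmonic map `Y` on `U` with unit normal `N`, which is itself weakly conformal and
orientation reversing. -/
structure IsMinimalPair (Y N : ℂ → E3) (U : Set ℂ) : Prop where
  isOpen : IsOpen U
  contDiffOn : ContDiffOn ℝ ∞ Y U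
  contDiffOn_normal : ContDiffOn ℝ ∞ N U
  pd_ne_zero : ∀ z ∈ U, pd 0 Y z ≠ 0
  unit : ∀ z ∈ U, ⟪N z, N z⟫ = 1
  perp : ∀ z ∈ U, ⟪N z, pd 0 Y z⟫ = 0
  perp_normal : ∀ z ∈ U, ⟪N z, pd 0 N z⟫ = 0
  rotate : ∀ z ∈ U, pd 1 Y z = cross (N z) (pd 0 Y z)
  rotate_normal : ∀ z ∈ U, pd 1 N z = -cross (N z) (pd 0 N z)
  harmonic : ∀ z ∈ U, pd 0 (pd 0 Y) z + pd 1 (pd 1 Y) z = 0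

section Conformal

variable {Y : ℂ → E3} {z : ℂ} {c : ℝ}

theorem inner_pd_of_conformal (hc : metric Y z = c • (1 : Matrix _ _ ℝ)) :
    ⟪pd 0 Y z, pd 0 Y z⟫ = c ∧ ⟪pd 0 Y z, pd 1 Y z⟫ = 0 ∧ ⟪pd 1 Y z, pd 1 Y z⟫ = c := by
  refine ⟨?_, ?_, ?_⟩
  · simpa [metric] using congrFun (congrFun hc 0) 0
  · simpa [metric] using congrFun (congrFun hc 0) 1
  · simpa [metric] using congrFun (congrFun hc 1) 1

theorem norm_cross_of_conformal (hc : metric Y z = c • (1 : Matrix _ _ ℝ)) :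
    ‖cross (pd 0 Y z) (pd 1 Y z)‖ = c := by
  obtain ⟨h0, h1, h2⟩ := inner_pd_of_conformal hc
  have hc0 : 0 ≤ c := h0 ▸ real_inner_self_nonneg
  rw [← sq_eq_sq₀ (norm_nonneg _) hc0, ← real_inner_self_eq_norm_sq, inner_cross_cross, h0, h2,
    real_inner_comm (pd 0 Y z) (pd 1 Y z), h1]
  ring

theorem cross_normal_of_conformal (hc : metric Y z = c • (1 : Matrix _ _ ℝ)) (hc0 : c ≠ 0) :
    cross (normal Y z) (pd 0 Y z) = pd 1 Y z ∧ cross (normal Y z) (pd 1 Y z) = -pd 0 Y z := by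
  obtain ⟨h0, h1, h2⟩ := inner_pd_of_conformal hc
  have h3 := h1
  rw [real_inner_comm] at h3
  simp only [normal, norm_cross_of_conformal hc, cross_smul_left, cross_cross, h0, h1, h2, h3]
  simp [smul_smul, inv_mul_cancel₀ hc0]

end Conformal

/-- In a conformal coordinate, $N\times$ acts on the tangent plane as the complex structure $J$. A
symmetric trace-free shape operator anticommutes with $J$, which gives `rotate_normal`. Harmonicity
of $Y$ follows by differentiating $Y_y=N\times Y_x$ and $Y_x=-N\times Y_y$ and using that $N\times
dY$ is closed. -/
theorem IsMinimalPatch.isMinimalPair {Y : ℂ → E3} {U : Set ℂ} (h : IsMinimalPatch Y U)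
    (hconf : ∀ z ∈ U, ∃ c : ℝ, metric Y z = c • (1 : Matrix _ _ ℝ)) :
    IsMinimalPair Y (normal Y) U := by
  have hne : ∀ z ∈ U, ∀ c : ℝ, metric Y z = c • (1 : Matrix _ _ ℝ) → c ≠ 0 := by
    intro z hz c hc
    rw [← norm_cross_of_conformal hc]
    exact norm_ne_zero_iff.2 (h.cross_ne z hz)
  have hrot : ∀ z ∈ U, pd 1 Y z = cross (normal Y z) (pd 0 Y z) := by
    intro z hz
    obtain ⟨c, hc⟩ := hconf z hz
    exact (cross_normal_of_conformal hc (hne z hz c hc)).1.symm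
  have hrot' : ∀ z ∈ U, pd 0 Y z = -cross (normal Y z) (pd 1 Y z) := by
    intro z hz
    obtain ⟨c, hc⟩ := hconf z hz
    rw [(cross_normal_of_conformal hc (hne z hz c hc)).2, neg_neg]
  refine ⟨h.isOpen, h.contDiffOn, h.contDiffOn_normal, ?_, fun z hz => h.inner_normal_normal hz,
    fun z hz => inner_normal_pd Y z 0, fun z hz => h.inner_normal_pd_normal hz 0, hrot, ?_, ?_⟩
  · intro z hz h0
    apply h.cross_ne z hz
    rw [h0]
    simp [cross]
  · intro z hz
    obtain ⟨c, hc⟩ := hconf z hz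
    have hc0 := hne z hz c hc
    have ht := h.trace_eq z hz
    rw [trace_shape] at ht
    replace ht := (mul_eq_zero.1 ht).resolve_left (inv_ne_zero (h.det_metric_ne_zero hz))
    rw [hc] at ht
    simp only [secondForm, Matrix.of_apply, Matrix.smul_apply, Matrix.one_apply_eq, smul_eq_mul,
      ne_eq, zero_ne_one, one_ne_zero, not_false_eq_true, Matrix.one_apply_ne, mul_one, mul_zero,
      zero_mul, sub_zero] at ht
    have ht' : ⟪pd 0 (normal Y) z, pd 0 Y z⟫ + ⟪pd 1 (normal Y) z, pd 1 Y z⟫ = 0 := by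
      refine (mul_eq_zero.1 (?_ : c * _ = 0)).resolve_left hc0
      linear_combination -ht
    have hsymm := h.secondForm_symm hz
    obtain ⟨hr, hr'⟩ := cross_normal_of_conformal hc hc0
    rw [← sub_eq_zero, sub_neg_eq_add]
    have hx : ⟪pd 1 (normal Y) z + cross (normal Y z) (pd 0 (normal Y) z), pd 0 Y z⟫ = 0 := by
      rw [inner_add_left, cross_anticomm, inner_neg_left, inner_cross_rotate, hr, hsymm]
      ring
    have hy : ⟪pd 1 (normal Y) z + cross (normal Y z) (pd 0 (normal Y) z), pd 1 Y z⟫ = 0 := by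
      rw [inner_add_left, cross_anticomm, inner_neg_left, inner_cross_rotate, hr', inner_neg_right]
      linarith
    refine eq_zero_of_inner_eq_zero (h.cross_ne z hz) hx hy ?_
    apply inner_normal_cross
    rw [inner_add_left, inner_cross_self_left, real_inner_comm, h.inner_normal_pd_normal hz,
      add_zero]
  · intro z hz
    have hev : ∀ᶠ w in 𝓝 z, w ∈ U := h.isOpen.mem_nhds hz
    have h1 : pd 1 (pd 1 Y) z = pd 1 (fun w => cross (normal Y w) (pd 0 Y w)) z :=
      pd_congr 1 (hev.mono hrot)
    have h0 : pd 0 (pd 0 Y) z = pd 0 (fun w => -cross (normal Y w) (pd 1 Y w)) z :=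
      pd_congr 0 (hev.mono hrot')
    have h0' : pd 0 (fun w => -cross (normal Y w) (pd 1 Y w)) z
        = -pd 0 (fun w => cross (normal Y w) (pd 1 Y w)) z := by
      simp [pd, fderiv_fun_neg]
    rw [h0, h0', h1, pd_cross (h.differentiableAt_normal hz) (h.differentiableAt_pd hz 1),
      pd_cross (h.differentiableAt_normal hz) (h.differentiableAt_pd hz 0),
      h.cross_pd_normal hz, pd_comm ((h.contDiffOn.contDiffAt (h.isOpen.mem_nhds hz)).of_le
        (by norm_cast))]
    abel

/-- The stereographic projection `(n¹ + i n²) / (1 - n³)`. -/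
def stereo (n : E3) : ℂ := ((n 0 : ℂ) + Complex.I * (n 1 : ℂ)) / (1 - (n 2 : ℂ))

/-- The coefficient `(∂ₓY¹ - i ∂ₓY²) - i (∂_yY¹ - i ∂_yY²)` of the Weierstrass representation. -/
def weierstrassCoeff (Y : ℂ → E3) (z : ℂ) : ℂ :=
  ((pd 0 Y z 0 : ℂ) - Complex.I * (pd 0 Y z 1 : ℂ)) -
    Complex.I * ((pd 1 Y z 0 : ℂ) - Complex.I * (pd 1 Y z 1 : ℂ))

/-- The quadratic form `- dN · dY` in the directions `(∂ₓ, ∂ₓ - i ∂_y)`. -/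
def pairHopf (Y N : ℂ → E3) (z : ℂ) : ℂ :=
  -(⟪pd 0 N z, pd 0 Y z⟫ : ℂ) + Complex.I * (⟪pd 0 N z, pd 1 Y z⟫ : ℂ)

theorem pd_add {f g : ℂ → ℂ} {z : ℂ} (hf : DifferentiableAt ℝ f z) (hg : DifferentiableAt ℝ g z)
    (i : Fin 2) : pd i (fun w => f w + g w) z = pd i f z + pd i g z := by
  simp [pd, fderiv_fun_add hf hg]

theorem pd_const_mul {f : ℂ → ℂ} {z : ℂ} (c : ℂ) (hf : DifferentiableAt ℝ f z)
    (i : Fin 2) : pd i (fun w => c * f w) z = c * pd i f z := by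
  simp [pd, fderiv_const_mul hf]

theorem differentiableAt_complex_of_pd {f : ℂ → ℂ} {z : ℂ} (hf : DifferentiableAt ℝ f z)
    (h : pd 1 f z = Complex.I * pd 0 f z) : DifferentiableAt ℂ f z :=
  differentiableAt_complex_iff_differentiableAt_real.2 ⟨hf, h⟩

theorem deriv_eq_pd {f : ℂ → ℂ} {z : ℂ} (hf : DifferentiableAt ℂ f z) : deriv f z = pd 0 f z := by
  have h : fderiv ℝ f z = (fderiv ℂ f z).restrictScalars ℝ := hf.fderiv_restrictScalars ℝ
  simp [pd, dir, h]

theorem differentiableAt_ofReal_apply {V : ℂ → E3} {z : ℂ} (hV : DifferentiableAt ℝ V z)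
    (k : Fin 3) : DifferentiableAt ℝ (fun w => (V w k : ℂ)) z :=
  Complex.ofRealCLM.differentiableAt.comp z
    ((EuclideanSpace.proj k : E3 →L[ℝ] ℝ).differentiableAt.comp z hV)

theorem pd_mul {f g : ℂ → ℂ} {z : ℂ} (hf : DifferentiableAt ℝ f z) (hg : DifferentiableAt ℝ g z)
    (i : Fin 2) : pd i (fun w => f w * g w) z = pd i f z * g z + f z * pd i g z := by
  simp [pd, fderiv_fun_mul hf hg]
  ring

theorem pd_const_sub {f : ℂ → ℂ} {z : ℂ} (c : ℂ) (i : Fin 2) :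
    pd i (fun w => c - f w) z = -pd i f z := by
  simp [pd, fderiv_const_sub]

theorem one_sub_apply_ne_zero {n : E3} (h : n 2 ≠ 1) : (1 : ℂ) - (n 2 : ℂ) ≠ 0 := by
  rw [sub_ne_zero]
  exact_mod_cast h.symm

theorem differentiableAt_stereo {N : ℂ → E3} {z : ℂ} (hN : DifferentiableAt ℝ N z)
    (h : N z 2 ≠ 1) : DifferentiableAt ℝ (fun w => stereo (N w)) z := by
  have hd (k) := differentiableAt_ofReal_apply hN k
  exact ((hd 0).add ((hd 1).const_mul Complex.I)).mul
    (((hd 2).const_sub 1).inv (one_sub_apply_ne_zero h))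

/-- The quotient rule with denominators cleared, so that later identities about $G'$ become
polynomial identities modulo the orthogonality relations. -/
theorem pd_stereo {N : ℂ → E3} {z : ℂ} (hN : DifferentiableAt ℝ N z) (h : N z 2 ≠ 1) (i : Fin 2) :
    pd i (fun w => stereo (N w)) z * (1 - (N z 2 : ℂ)) ^ 2 =
      ((pd i N z 0 : ℂ) + Complex.I * (pd i N z 1 : ℂ)) * (1 - (N z 2 : ℂ)) +
        ((N z 0 : ℂ) + Complex.I * (N z 1 : ℂ)) * (pd i N z 2 : ℂ) := by
  have hne := one_sub_apply_ne_zero h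
  have hd (k) := differentiableAt_ofReal_apply hN k
  have h1 : (fun w => stereo (N w) * (1 - (N w 2 : ℂ))) =ᶠ[𝓝 z]
      fun w => (N w 0 : ℂ) + Complex.I * (N w 1 : ℂ) := by
    have hc : ContinuousAt (fun w => (1 : ℂ) - (N w 2 : ℂ)) z :=
      ((hd 2).const_sub 1).continuousAt
    filter_upwards [hc.eventually_ne hne] with w hw
    exact div_mul_cancel₀ _ hw
  have h2 := pd_congr i h1
  rw [pd_mul (differentiableAt_stereo hN h) ((hd 2).const_sub 1), pd_const_sub,
    pd_add (hd 0) ((hd 1).const_mul _), pd_const_mul _ (hd 1)] at h2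
  simp only [pd_ofReal_apply hN] at h2
  have h3 : stereo (N z) * (1 - (N z 2 : ℂ)) = (N z 0 : ℂ) + Complex.I * (N z 1 : ℂ) :=
    div_mul_cancel₀ _ hne
  linear_combination (1 - (N z 2 : ℂ)) * h2 + (pd i N z 2 : ℂ) * h3

namespace IsMinimalPair

variable {Y N : ℂ → E3} {U : Set ℂ} {z : ℂ}

theorem differentiableAt_normal (h : IsMinimalPair Y N U) (hz : z ∈ U) : DifferentiableAt ℝ N z :=
  (h.contDiffOn_normal.contDiffAt (h.isOpen.mem_nhds hz)).differentiableAt (by simp)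

theorem differentiableAt_pd (h : IsMinimalPair Y N U) (hz : z ∈ U) (i : Fin 2) :
    DifferentiableAt ℝ (pd i Y) z :=
  ((contDiffOn_pd h.isOpen h.contDiffOn i).contDiffAt (h.isOpen.mem_nhds hz)).differentiableAt
    (by simp)

/-- The stereographically projected normal is holomorphic. -/
theorem differentiableAt_stereo (h : IsMinimalPair Y N U) (hz : z ∈ U) (h1 : N z 2 ≠ 1) :
    DifferentiableAt ℂ (fun w => stereo (N w)) z := by
  have hN := h.differentiableAt_normal hz
  have hne := one_sub_apply_ne_zero h1
  apply differentiableAt_complex_of_pd (EntropySurface.differentiableAt_stereo hN h1)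
  -- After clearing denominators, the Cauchy–Riemann equation is a combination of $|N|^2=1$ and
  -- $N\cdot N_x=0$.
  apply mul_right_cancel₀ (pow_ne_zero 2 hne)
  rw [mul_assoc, pd_stereo hN h1, pd_stereo hN h1, h.rotate_normal z hz]
  have hu := h.unit z hz
  have hp := h.perp_normal z hz
  rw [inner_eq_sum] at hu hp
  simp only [PiLp.neg_apply, cross_apply_zero, cross_apply_one, cross_apply_two]
  apply Complex.ext
  · simp
    linear_combination (-pd 0 N z 1) * hu + (N z 1) * hp
  · simp
    linear_combination pd 0 N z 0 * hu - N z 0 * hp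

/-- The Weierstrass coefficient is holomorphic. -/
theorem differentiableAt_weierstrassCoeff (h : IsMinimalPair Y N U) (hz : z ∈ U) :
    DifferentiableAt ℂ (weierstrassCoeff Y) z := by
  have hd (i k) := differentiableAt_ofReal_apply (h.differentiableAt_pd hz i) k
  have hsub {f g : ℂ → ℂ} (hf : DifferentiableAt ℝ f z) (hg : DifferentiableAt ℝ g z)
      (i : Fin 2) : pd i (fun w => f w - g w) z = pd i f z - pd i g z := by
    simp [pd, fderiv_fun_sub hf hg]
  have h0 (i) := (hd i 0).fun_sub ((hd i 1).const_mul Complex.I)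
  have h1 : DifferentiableAt ℝ (weierstrassCoeff Y) z := (h0 0).sub ((h0 1).const_mul Complex.I)
  have h2 (i) : pd i (weierstrassCoeff Y) z =
      ((pd i (pd 0 Y) z 0 : ℂ) - Complex.I * (pd i (pd 0 Y) z 1 : ℂ)) -
        Complex.I * ((pd i (pd 1 Y) z 0 : ℂ) - Complex.I * (pd i (pd 1 Y) z 1 : ℂ)) := by
    unfold weierstrassCoeff
    rw [hsub (h0 0) ((h0 1).const_mul Complex.I), pd_const_mul _ (h0 1),
      hsub (hd 0 0) ((hd 0 1).const_mul _), hsub (hd 1 0) ((hd 1 1).const_mul _),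
      pd_const_mul _ (hd 0 1), pd_const_mul _ (hd 1 1)]
    simp only [pd_ofReal_apply (h.differentiableAt_pd hz _)]
  apply differentiableAt_complex_of_pd h1
  have h3 := pd_comm ((h.contDiffOn.contDiffAt (h.isOpen.mem_nhds hz)).of_le
    (by norm_cast : (2 : WithTop ℕ∞) ≤ ∞)) 1 0
  have h4 := eq_neg_of_add_eq_zero_right (h.harmonic z hz)
  rw [h2, h2, h3, h4]
  apply Complex.ext <;> simp [add_comm, sub_eq_add_neg]

/-- Vanishing of the coefficient, together with $N\cdot Y_x=0$ and $|N|=1$, forces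
$(1-N^3)\,\partial_xY^3=0$; the other two components of $Y_x$ then vanish as well, against
immersion. -/
theorem weierstrassCoeff_ne_zero (h : IsMinimalPair Y N U) (hz : z ∈ U) (h1 : N z 2 ≠ 1) :
    weierstrassCoeff Y z ≠ 0 := by
  intro h0
  apply h.pd_ne_zero z hz
  have hu := h.unit z hz
  have hp := h.perp z hz
  rw [inner_eq_sum] at hu hp
  rw [weierstrassCoeff, h.rotate z hz] at h0
  have hre := congrArg Complex.re h0
  have him := congrArg Complex.im h0
  simp [cross_apply_zero, cross_apply_one] at hre him
  have ht : 1 - N z 2 ≠ 0 := sub_ne_zero.2 h1.symm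
  have h2 : pd 0 Y z 2 = 0 := by
    apply mul_left_cancel₀ ht
    linear_combination N z 0 * hre - N z 1 * him - (1 - N z 2) * hp - pd 0 Y z 2 * hu
  rw [h2] at hre him
  apply E3.ext_three
  · apply mul_left_cancel₀ ht
    simp only [PiLp.zero_apply]
    linear_combination hre
  · apply mul_left_cancel₀ ht
    simp only [PiLp.zero_apply]
    linear_combination -him
  · simpa using h2

/-- The Hopf differential is the product of the Weierstrass coefficient and `dG`. -/
theorem pairHopf_eq (h : IsMinimalPair Y N U) (hz : z ∈ U) (h1 : N z 2 ≠ 1) :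
    pairHopf Y N z = -(weierstrassCoeff Y z * deriv (fun w => stereo (N w)) z) := by
  have hN := h.differentiableAt_normal hz
  have hne := one_sub_apply_ne_zero h1
  apply mul_right_cancel₀ (pow_ne_zero 2 hne)
  rw [deriv_eq_pd (h.differentiableAt_stereo hz h1), neg_mul, mul_assoc, pd_stereo hN h1,
    pairHopf, weierstrassCoeff, h.rotate z hz]
  have hu := h.unit z hz
  have hp := h.perp z hz
  have hq := h.perp_normal z hz
  rw [inner_eq_sum] at hu hp hq
  simp only [inner_eq_sum, cross_apply_zero, cross_apply_one, cross_apply_two]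
  apply Complex.ext
  · simp [sq]
    linear_combination pd 0 Y z 2 * pd 0 N z 2 * hu + (1 - N z 2) * pd 0 N z 2 * hp +
      (1 - N z 2) * pd 0 Y z 2 * hq
  · simp [sq]
    linear_combination (1 - N z 2) *
      (-(pd 0 Y z 0 * pd 0 N z 1 - pd 0 Y z 1 * pd 0 N z 0) * hu -
        (N z 0 * pd 0 Y z 1 - N z 1 * pd 0 Y z 0) * hq -
        (N z 1 * pd 0 N z 0 - N z 0 * pd 0 N z 1) * hp)

end IsMinimalPair

/-! ### The half-turn exchanging the two poles -/

/-- The half-turn `(v⁰, v¹, v²) ↦ (v⁰, -v¹, -v²)`. -/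
def halfTurn : E3 →L[ℝ] E3 :=
  LinearMap.toContinuousLinearMap
    { toFun := fun v => !₂[v 0, -v 1, -v 2]
      map_add' := fun v w => by
        apply E3.ext_three <;> simp <;> ring
      map_smul' := fun c v => by
        apply E3.ext_three <;> simp }

@[simp] theorem halfTurn_zero (v : E3) : halfTurn v 0 = v 0 := rfl
@[simp] theorem halfTurn_one (v : E3) : halfTurn v 1 = -v 1 := rfl
@[simp] theorem halfTurn_two (v : E3) : halfTurn v 2 = -v 2 := rfl

theorem inner_halfTurn (v w : E3) : ⟪halfTurn v, halfTurn w⟫ = ⟪v, w⟫ := by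
  simp [inner_eq_sum]

theorem cross_halfTurn (v w : E3) : cross (halfTurn v) (halfTurn w) = halfTurn (cross v w) := by
  apply E3.ext_three <;>
    simp [cross_apply_zero, cross_apply_one, cross_apply_two] <;> ring

/-- This is $(n^1+in^2)(n^1-in^2)=(1+n^3)(1-n^3)$ in quotient form. It persists at both poles, where
division by zero makes both sides $0$. -/
theorem stereo_eq_inv {n : E3} (h : ⟪n, n⟫ = 1) : stereo n = (stereo (halfTurn n))⁻¹ := by
  rw [inner_eq_sum] at h
  have h' : (n 0 : ℂ) * n 0 + n 1 * n 1 + n 2 * n 2 = 1 := by exact_mod_cast h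
  simp only [stereo, halfTurn_zero, halfTurn_one, halfTurn_two, inv_div, Complex.ofReal_neg,
    sub_neg_eq_add]
  have h2 : ((n 0 : ℂ) + Complex.I * n 1) * (n 0 + Complex.I * -n 1) =
      (1 + n 2) * (1 - n 2) := by
    linear_combination h' - (n 1 : ℂ) * n 1 * Complex.I_sq
  by_cases h3 : (n 0 : ℂ) + Complex.I * -n 1 = 0
  · have h4 : (n 0 : ℂ) + Complex.I * n 1 = 0 := by
      have := congrArg (starRingEnd ℂ) h3
      simpa using this
    rw [h3, h4]
    simp
  · by_cases h4 : (1 : ℂ) - n 2 = 0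
    · exfalso
      rw [h4, mul_zero] at h2
      have h5 := (mul_eq_zero.1 h2).resolve_right h3
      have := congrArg (starRingEnd ℂ) h5
      simp at this
      exact h3 (by linear_combination this)
    · rw [div_eq_div_iff h4 h3]
      exact h2

namespace IsMinimalPair

variable {Y N : ℂ → E3} {U : Set ℂ} {z : ℂ}

/-- Turning $Y$ and $N$ together replaces $G$ by $1/G$ and preserves the Hopf coefficient, so poles
of $G$ reduce to points where the Gauss map is finite. -/
theorem halfTurn (h : IsMinimalPair Y N U) :
    IsMinimalPair (fun w => halfTurn (Y w)) (fun w => halfTurn (N w)) U := by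
  have hd : ∀ z ∈ U, DifferentiableAt ℝ Y z := fun z hz =>
    (h.contDiffOn.contDiffAt (h.isOpen.mem_nhds hz)).differentiableAt (by simp)
  have hY (i) : ∀ z ∈ U, pd i (fun w => EntropySurface.halfTurn (Y w)) z =
      EntropySurface.halfTurn (pd i Y z) := fun z hz => pd_clm_comp _ (hd z hz) i
  have hN (i) : ∀ z ∈ U, pd i (fun w => EntropySurface.halfTurn (N w)) z =
      EntropySurface.halfTurn (pd i N z) := fun z hz =>
    pd_clm_comp _ (h.differentiableAt_normal hz) i
  have hYY (i) : ∀ z ∈ U, pd i (pd i (fun w => EntropySurface.halfTurn (Y w))) z =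
      EntropySurface.halfTurn (pd i (pd i Y) z) := fun z hz => by
    rw [← pd_clm_comp _ (h.differentiableAt_pd hz i)]
    apply pd_congr
    filter_upwards [h.isOpen.mem_nhds hz] with w hw using hY i w hw
  refine ⟨h.isOpen, EntropySurface.halfTurn.contDiff.comp_contDiffOn h.contDiffOn,
    EntropySurface.halfTurn.contDiff.comp_contDiffOn h.contDiffOn_normal, ?_, ?_, ?_, ?_, ?_, ?_,
    ?_⟩
  · intro z hz h0
    rw [hY 0 z hz] at h0
    apply h.pd_ne_zero z hz
    rw [← inner_self_eq_zero (𝕜 := ℝ), ← inner_halfTurn, h0, inner_zero_left]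
  · intro z hz
    rw [inner_halfTurn, h.unit z hz]
  · intro z hz
    rw [hY 0 z hz, inner_halfTurn, h.perp z hz]
  · intro z hz
    rw [hN 0 z hz, inner_halfTurn, h.perp_normal z hz]
  · intro z hz
    rw [hY 0 z hz, hY 1 z hz, cross_halfTurn, h.rotate z hz]
  · intro z hz
    rw [hN 0 z hz, hN 1 z hz, cross_halfTurn, h.rotate_normal z hz, map_neg]
  · intro z hz
    rw [hYY 0 z hz, hYY 1 z hz, ← map_add, h.harmonic z hz, map_zero]

theorem pairHopf_halfTurn (h : IsMinimalPair Y N U) (hz : z ∈ U) :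
    pairHopf (fun w => EntropySurface.halfTurn (Y w)) (fun w => EntropySurface.halfTurn (N w)) z =
      pairHopf Y N z := by
  have hd : DifferentiableAt ℝ Y z :=
    (h.contDiffOn.contDiffAt (h.isOpen.mem_nhds hz)).differentiableAt (by simp)
  simp only [pairHopf, pd_clm_comp _ hd, pd_clm_comp _ (h.differentiableAt_normal hz),
    inner_halfTurn]

theorem eventually_ne_one (h : IsMinimalPair Y N U) (hz : z ∈ U) (h1 : N z 2 ≠ 1) :
    ∀ᶠ w in 𝓝 z, w ∈ U ∧ N w 2 ≠ 1 := by
  have hc : ContinuousAt (fun w => N w 2) z :=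
    ((EuclideanSpace.proj 2 : E3 →L[ℝ] ℝ).continuous.continuousAt).comp
      (h.differentiableAt_normal hz).continuousAt
  exact (h.isOpen.eventually_mem hz).and (hc.eventually_ne h1)

theorem analyticAt_stereo (h : IsMinimalPair Y N U) (hz : z ∈ U) (h1 : N z 2 ≠ 1) :
    AnalyticAt ℂ (fun w => stereo (N w)) z :=
  Complex.analyticAt_iff_eventually_differentiableAt.2
    ((h.eventually_ne_one hz h1).mono fun _ hw => h.differentiableAt_stereo hw.1 hw.2)

theorem analyticAt_weierstrassCoeff (h : IsMinimalPair Y N U) (hz : z ∈ U) :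
    AnalyticAt ℂ (weierstrassCoeff Y) z :=
  Complex.analyticAt_iff_eventually_differentiableAt.2
    (eventually_of_mem (h.isOpen.mem_nhds hz) fun _ hw => h.differentiableAt_weierstrassCoeff hw)

theorem pairHopf_eventuallyEq (h : IsMinimalPair Y N U) (hz : z ∈ U) (h1 : N z 2 ≠ 1) :
    pairHopf Y N =ᶠ[𝓝 z] -(weierstrassCoeff Y * deriv (fun w => stereo (N w))) :=
  (h.eventually_ne_one hz h1).mono fun _ hw => h.pairHopf_eq hw.1 hw.2

theorem analyticAt_pairHopf (h : IsMinimalPair Y N U) (hz : z ∈ U) :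
    AnalyticAt ℂ (pairHopf Y N) z := by
  have key {Y N : ℂ → E3} (h : IsMinimalPair Y N U) (h1 : N z 2 ≠ 1) :
      AnalyticAt ℂ (pairHopf Y N) z :=
    (((h.analyticAt_weierstrassCoeff hz).mul (h.analyticAt_stereo hz h1).deriv).neg).congr
      (h.pairHopf_eventuallyEq hz h1).symm
  by_cases h1 : N z 2 = 1
  · refine (key h.halfTurn ?_).congr
      (eventually_of_mem (h.isOpen.mem_nhds hz) fun w hw => h.pairHopf_halfTurn hw)
    rw [halfTurn_two, h1]
    norm_num
  · exact key h h1

/-- In the factorisation of the Hopf coefficient, the Weierstrass factor is a unit. -/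
theorem analyticOrderAt_deriv_stereo (h : IsMinimalPair Y N U) (hz : z ∈ U) (h1 : N z 2 ≠ 1) :
    analyticOrderAt (deriv fun w => stereo (N w)) z = analyticOrderAt (pairHopf Y N) z := by
  rw [analyticOrderAt_congr (h.pairHopf_eventuallyEq hz h1), analyticOrderAt_neg,
    analyticOrderAt_mul (h.analyticAt_weierstrassCoeff hz) (h.analyticAt_stereo hz h1).deriv,
    (h.analyticAt_weierstrassCoeff hz).analyticOrderAt_eq_zero.2
      (h.weierstrassCoeff_ne_zero hz h1), zero_add]

/-- At a zero of order `n` of the Hopf differential, the derivative of the Gauss map has a zero of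
order `n`, or a pole of order `n + 2`. -/
theorem exists_hasLeadingTerm_stereo (h : IsMinimalPair Y N U) (hz : z ∈ U) {n : ℕ}
    (hn : analyticOrderAt (pairHopf Y N) z = n) :
    (∀ᶠ w in 𝓝[≠] z, N w 2 ≠ 1) ∧ ∃ k : ℤ, (k = n ∨ k = -(n + 2)) ∧
      ∃ b ≠ 0, HasLeadingTerm (dz fun w => stereo (N w)) z k b := by
  by_cases h1 : N z 2 = 1
  · have h2 : EntropySurface.halfTurn (N z) 2 ≠ 1 := by
      rw [halfTurn_two, h1]
      norm_num
    have hH := h.halfTurn.analyticAt_stereo hz h2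
    have hq : pairHopf (fun w => EntropySurface.halfTurn (Y w))
        (fun w => EntropySurface.halfTurn (N w)) =ᶠ[𝓝 z] pairHopf Y N :=
      eventually_of_mem (h.isOpen.mem_nhds hz) fun w hw => h.pairHopf_halfTurn hw
    have h3 := h.halfTurn.analyticOrderAt_deriv_stereo hz h2
    rw [analyticOrderAt_congr hq, hn] at h3
    have h01 : N z 0 = 0 ∧ N z 1 = 0 := by
      have := h.unit z hz
      rw [inner_eq_sum, h1] at this
      constructor <;> nlinarith [mul_self_nonneg (N z 0), mul_self_nonneg (N z 1)]
    have h4 : stereo (EntropySurface.halfTurn (N z)) = 0 := by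
      simp [stereo, h01.1, h01.2]
    -- Since $1/G$ vanishes at $z$ and its derivative has order $n$, it has order $n+1$ itself;
    -- hence $G'$ has a pole of order $n+2$.
    have h5 := (analyticOrderAt_deriv_eq_iff hH h4).2 h3
    obtain ⟨a, ha, hlead⟩ := HasLeadingTerm.of_analyticOrderAt (n := n + 1) hH
      (by rw [h5]; norm_cast)
    have hG : (fun w => stereo (N w)) =ᶠ[𝓝[≠] z]
        fun w => (stereo (EntropySurface.halfTurn (N w)))⁻¹ :=
      (eventually_of_mem (h.isOpen.mem_nhds hz) fun w hw =>
        stereo_eq_inv (h.unit w hw)).filter_mono nhdsWithin_le_nhds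
    have h6 := (hlead.inv ha).congr hG
    refine ⟨?_, -(n + 2), Or.inr rfl,
      (((-((n + 1 : ℕ) : ℤ)) : ℤ) : ℂ) * a⁻¹, ?_, ?_⟩
    -- The north pole is attained only where $1/G=0$, and zeros of $1/G$ are isolated here.
    · filter_upwards [hlead.eventually_ne_zero ha,
        (h.isOpen.eventually_mem hz).filter_mono nhdsWithin_le_nhds] with w hw hU h7
      apply hw
      have := h.unit w hU
      rw [inner_eq_sum, h7] at this
      have h8 : N w 0 = 0 ∧ N w 1 = 0 := by
        constructor <;> nlinarith [mul_self_nonneg (N w 0), mul_self_nonneg (N w 1)]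
      simp [stereo, h8.1, h8.2]
    · apply mul_ne_zero _ (inv_ne_zero ha)
      push_cast
      rw [neg_ne_zero]
      exact_mod_cast Nat.succ_ne_zero n
    · have h9 := h6.deriv.congr h6.dz_eventuallyEq
      convert h9 using 1
      push_cast
      ring
  · have hG := h.analyticAt_stereo hz h1
    have h2 := h.analyticOrderAt_deriv_stereo hz h1
    rw [hn] at h2
    obtain ⟨a, ha, hlead⟩ := HasLeadingTerm.of_analyticOrderAt hG.deriv h2
    refine ⟨(h.eventually_ne_one hz h1).filter_mono nhdsWithin_le_nhds |>.mono fun w hw => hw.2,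
      n, Or.inl rfl, a, ha, hlead.congr ?_⟩
    exact (hG.eventually_analyticAt.filter_mono nhdsWithin_le_nhds).mono fun w hw =>
      dz_eq_deriv hw.differentiableAt

end IsMinimalPair

/-! ### The flat metric and the entropy differentials of a conformal minimal patch -/

/-- The connection coefficient of a conformal metric `ρ (dx² + dy²)` is `∂_z ρ / ρ`. -/
theorem connectionCoeff_of_conformal {h : ℂ → Matrix (Fin 2) (Fin 2) ℝ} {ρ : ℂ → ℝ} {z : ℂ}
    (hh : h =ᶠ[𝓝 z] fun w => ρ w • (1 : Matrix _ _ ℝ)) :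
    connectionCoeff h z = (((pd 0 ρ z : ℝ) : ℂ) - Complex.I * ((pd 1 ρ z : ℝ) : ℂ)) / 2 /
        (ρ z : ℂ) := by
  have hpd (i j k : Fin 2) : pd i (fun w => h w j k) z = if j = k then pd i ρ z else 0 := by
    have h1 : (fun w => h w j k) =ᶠ[𝓝 z] fun w => if j = k then ρ w else 0 := by
      filter_upwards [hh] with w hw
      rw [hw]
      simp [Matrix.one_apply]
    rw [pd_congr i h1]
    split_ifs
    · rfl
    · simp [pd]
  have hinv : (h z)⁻¹ = (ρ z)⁻¹ • (1 : Matrix _ _ ℝ) := by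
    rw [hh.eq_of_nhds]
    by_cases h0 : ρ z = 0
    · simp [h0]
    · apply Matrix.inv_eq_left_inv
      simp [smul_smul, h0]
  simp only [connectionCoeff, christoffel, hpd, hinv, Fin.sum_univ_two, Matrix.smul_apply,
    smul_eq_mul, Matrix.cons_val_zero, Matrix.cons_val_one]
  simp
  ring_nf
  simp only [Complex.I_sq, show Complex.I ^ 3 = -Complex.I by rw [pow_succ, Complex.I_sq]; ring]
  ring

/-- This is $\partial_z\log|q|=q'/(2q)$, obtained from $|q|^2=q\bar q$ and $\partial_z\bar q=0$. -/
theorem pd_norm {q : ℂ → ℂ} {z : ℂ} (hq : DifferentiableAt ℂ q z) (h0 : q z ≠ 0) :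
    (((pd 0 (fun w => ‖q w‖) z : ℝ) : ℂ) - Complex.I * ((pd 1 (fun w => ‖q w‖) z : ℝ) : ℂ)) / 2 /
        (‖q z‖ : ℂ)
      = deriv q z / (2 * q z) := by
  have hqr : DifferentiableAt ℝ q z := hq.restrictScalars ℝ
  have hn : DifferentiableAt ℝ (fun w => ‖q w‖) z := hqr.norm ℝ h0
  have hI : pd 1 q z = Complex.I * pd 0 q z :=
    (differentiableAt_complex_iff_differentiableAt_real.1 hq).2
  have hpd (i : Fin 2) : ‖q z‖ * pd i (fun w => ‖q w‖) z =
      (q z).re * (pd i q z).re + (q z).im * (pd i q z).im := by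
    have h1 := (hn.hasFDerivAt.pow 2).fderiv
    have h2 := (hqr.hasFDerivAt.norm_sq).fderiv
    have h3 := congrArg (fun L : ℂ →L[ℝ] ℝ => L (dir i)) (h1.symm.trans h2)
    simp [Complex.inner] at h3
    simp only [pd]
    linarith
  have hz : (‖q z‖ : ℂ) ≠ 0 := by exact_mod_cast norm_ne_zero_iff.2 h0
  have hsq : (‖q z‖ : ℂ) * ‖q z‖ = q z * starRingEnd ℂ (q z) := by
    rw [Complex.mul_conj, Complex.normSq_eq_norm_sq]
    push_cast
    ring
  have h4 : (‖q z‖ : ℂ) * (((pd 0 (fun w => ‖q w‖) z : ℝ) : ℂ) -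
      Complex.I * ((pd 1 (fun w => ‖q w‖) z : ℝ) : ℂ)) = starRingEnd ℂ (q z) * deriv q z := by
    have e0 : (‖q z‖ : ℂ) * ((pd 0 (fun w => ‖q w‖) z : ℝ) : ℂ) =
        (q z).re * (pd 0 q z).re + (q z).im * (pd 0 q z).im := by exact_mod_cast hpd 0
    have e1 : (‖q z‖ : ℂ) * ((pd 1 (fun w => ‖q w‖) z : ℝ) : ℂ) =
        (q z).re * (pd 1 q z).re + (q z).im * (pd 1 q z).im := by exact_mod_cast hpd 1
    rw [deriv_eq_pd hq, mul_sub, mul_left_comm, e0, e1, hI]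
    apply Complex.ext <;> simp <;> ring
  rw [div_div, div_eq_div_iff (mul_ne_zero two_ne_zero hz) (mul_ne_zero two_ne_zero h0)]
  apply mul_left_cancel₀ hz
  linear_combination 2 * q z * h4 - 2 * deriv q z * hsq

theorem hopf_eq_pairHopf (Y : ℂ → E3) : hopf Y = pairHopf Y (normal Y) := by
  funext z
  simp [hopf, pairHopf, secondForm]

namespace IsMinimalPatch

variable {Y : ℂ → E3} {U : Set ℂ} {z : ℂ}

theorem secondForm_eq (h : IsMinimalPatch Y U) (hz : z ∈ U) {c : ℝ}
    (hc : metric Y z = c • (1 : Matrix _ _ ℝ)) :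
    c ≠ 0 ∧ secondForm Y z 1 1 = -secondForm Y z 0 0 ∧
      secondForm Y z 1 0 = secondForm Y z 0 1 := by
  have hc0 : c ≠ 0 := by
    rw [← norm_cross_of_conformal hc]
    exact norm_ne_zero_iff.2 (h.cross_ne z hz)
  refine ⟨hc0, ?_, ?_⟩
  · have ht := h.trace_eq z hz
    rw [trace_shape] at ht
    replace ht := (mul_eq_zero.1 ht).resolve_left (inv_ne_zero (h.det_metric_ne_zero hz))
    rw [hc] at ht
    simp only [Matrix.smul_apply, Matrix.one_apply_eq, smul_eq_mul, ne_eq, zero_ne_one,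
      one_ne_zero, not_false_eq_true, Matrix.one_apply_ne, mul_one, mul_zero, zero_mul,
      sub_zero] at ht
    apply mul_left_cancel₀ hc0
    linarith
  · simpa [secondForm] using h.secondForm_symm hz

theorem shape_eq (h : IsMinimalPatch Y U) (hz : z ∈ U) {c : ℝ}
    (hc : metric Y z = c • (1 : Matrix _ _ ℝ)) : shape Y z = c⁻¹ • secondForm Y z := by
  have hinv : (metric Y z)⁻¹ = c⁻¹ • (1 : Matrix _ _ ℝ) := by
    rw [hc]
    apply Matrix.inv_eq_left_inv
    simp [smul_smul, (h.secondForm_eq hz hc).1]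
  rw [shape, hinv, Matrix.smul_mul, one_mul]

theorem norm_hopf_sq (Y : ℂ → E3) (z : ℂ) :
    ‖hopf Y z‖ ^ 2 = secondForm Y z 0 0 ^ 2 + secondForm Y z 0 1 ^ 2 := by
  rw [← Complex.normSq_eq_norm_sq, Complex.normSq_apply]
  simp [hopf]
  ring

/-- The flat metric of a conformal minimal patch is `|q| (dx² + dy²)`. -/
theorem flatMetric_eq (h : IsMinimalPatch Y U) (hz : z ∈ U)
    (hconf : ∃ c : ℝ, metric Y z = c • (1 : Matrix _ _ ℝ)) :
    flatMetric Y z = ‖hopf Y z‖ • (1 : Matrix _ _ ℝ) := by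
  obtain ⟨c, hc⟩ := hconf
  obtain ⟨hc0, h1, h2⟩ := h.secondForm_eq hz hc
  have hpos : 0 < c := lt_of_le_of_ne (norm_cross_of_conformal hc ▸ norm_nonneg _) hc0.symm
  -- With $A$ trace-free and $g=c\,|dz|^2$, one has $K=-|q|^2/c^2$; positivity of $c$ makes
  -- $\sqrt{-K}\,c=|q|$.
  have hK : -patchGaussCurvature Y z = (c⁻¹ * ‖hopf Y z‖) ^ 2 := by
    rw [patchGaussCurvature, h.shape_eq hz hc, mul_pow, norm_hopf_sq, Matrix.det_fin_two]
    simp only [Matrix.smul_apply, smul_eq_mul, h1, h2]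
    ring
  rw [flatMetric, hK, Real.sqrt_sq (by positivity), hc, smul_smul]
  congr 1
  field_simp

/-- A point of a conformal minimal patch is umbilic if and only if the Hopf differential
vanishes there. -/
theorem hopf_eq_zero_iff (h : IsMinimalPatch Y U) (hz : z ∈ U)
    (hconf : ∃ c : ℝ, metric Y z = c • (1 : Matrix _ _ ℝ)) :
    hopf Y z = 0 ↔ ∃ κ : ℝ, shape Y z = κ • (1 : Matrix _ _ ℝ) := by
  obtain ⟨c, hc⟩ := hconf
  obtain ⟨hc0, h1, h2⟩ := h.secondForm_eq hz hc
  rw [h.shape_eq hz hc]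
  have hq : hopf Y z = 0 ↔ secondForm Y z 0 0 = 0 ∧ secondForm Y z 0 1 = 0 := by
    rw [Complex.ext_iff]
    simp [hopf]
  rw [hq]
  constructor
  · rintro ⟨h3, h4⟩
    refine ⟨0, ?_⟩
    ext i j
    fin_cases i <;> fin_cases j <;> simp [h1, h2, h3, h4]
  · rintro ⟨κ, hκ⟩
    have e (i j : Fin 2) := congrFun (congrFun hκ i) j
    have e00 := e 0 0
    have e11 := e 1 1
    have e01 := e 0 1
    simp [hc0, h1] at e00 e01 e11
    refine ⟨?_, e01⟩
    have : c⁻¹ * secondForm Y z 0 0 = 0 := by linarith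
    exact (mul_eq_zero.1 this).resolve_left (inv_ne_zero hc0)

theorem analyticAt_hopf (h : IsMinimalPatch Y U)
    (hconf : ∀ z ∈ U, ∃ c : ℝ, metric Y z = c • (1 : Matrix _ _ ℝ)) (hz : z ∈ U) : AnalyticAt ℂ
        (hopf Y) z := by
  rw [hopf_eq_pairHopf]
  exact (h.isMinimalPair hconf).analyticAt_pairHopf hz

theorem connectionCoeff_eq (h : IsMinimalPatch Y U)
    (hconf : ∀ z ∈ U, ∃ c : ℝ, metric Y z = c • (1 : Matrix _ _ ℝ)) (hz : z ∈ U)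
        (h0 : hopf Y z ≠ 0) :
    connectionCoeff (flatMetric Y) z = deriv (hopf Y) z / (2 * hopf Y z) := by
  have h1 : flatMetric Y =ᶠ[𝓝 z] fun w => ‖hopf Y w‖ • (1 : Matrix _ _ ℝ) :=
    eventually_of_mem (h.isOpen.mem_nhds hz) fun w hw => h.flatMetric_eq hw (hconf w hw)
  rw [connectionCoeff_of_conformal h1, pd_norm (h.analyticAt_hopf hconf hz).differentiableAt h0]

/-- The logarithmic derivative of $q$ has residue $n$, and $\gamma$ is half of it. -/
theorem hasLeadingTerm_connectionCoeff (h : IsMinimalPatch Y U)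
    (hconf : ∀ z ∈ U, ∃ c : ℝ, metric Y z = c • (1 : Matrix _ _ ℝ)) (hz : z ∈ U) {n : ℕ}
    (hn : analyticOrderAt (hopf Y) z = n) :
    HasLeadingTerm (connectionCoeff (flatMetric Y)) z (-1) (n / 2) := by
  obtain ⟨a, ha, hq⟩ := HasLeadingTerm.of_analyticOrderAt (h.analyticAt_hopf hconf hz) hn
  have h1 := (hq.deriv.div hq ha).const_mul (1 / 2)
  rw [show (n : ℤ) - 1 - n = -1 by ring] at h1
  have h2 : (1 / 2 : ℂ) * (((n : ℤ) : ℂ) * a / a) = n / 2 := by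
    rw [mul_div_cancel_right₀ _ ha]
    push_cast
    ring
  rw [h2] at h1
  refine h1.congr ?_
  filter_upwards [hq.eventually_ne_zero ha,
    (h.isOpen.eventually_mem hz).filter_mono nhdsWithin_le_nhds] with w hw hU
  rw [h.connectionCoeff_eq hconf hU hw]
  field_simp

/-- The leading terms of the entropy differentials at a zero of order `n` of the Hopf
differential. -/
theorem hasLeadingTerm_entropy (h : IsMinimalPatch Y U)
    (hconf : ∀ z ∈ U, ∃ c : ℝ, metric Y z = c • (1 : Matrix _ _ ℝ)) (hz : z ∈ U) {n : ℕ}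
        (hn : analyticOrderAt (hopf Y) z = n) :
    ∃ b : ℂ, b = -(n * (3 * n + 4)) / 8 ∧
      HasLeadingTerm (entropy Y 2) z (-2) b ∧
      HasLeadingTerm (entropy Y 3) z (-3) (-(n + 2) * b) ∧
      HasLeadingTerm (entropy Y 5) z (-5) (-3 * (n + 2) ^ 3 * b) := by
  have hγ := h.hasLeadingTerm_connectionCoeff hconf hz hn
  have hn' := hn
  rw [hopf_eq_pairHopf] at hn'
  obtain ⟨hN, k, hk, b, hb, hG⟩ := (h.isMinimalPair hconf).exists_hasLeadingTerm_stereo hz hn'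
  have h2 : HasLeadingTerm (entropy Y 2) z (-2) (-(n * (3 * n + 4)) / 8) := by
    have h1 := hasLeadingTerm_schwarzian hb hG hγ
    -- The left side is $-\tfrac12(k-\tfrac n2)(k+2+\tfrac n2)$, symmetric under $k\mapsto -2-k$,
    -- which exchanges the two cases. This reflects the invariance of the Schwarzian under $G\mapsto
    -- 1/G$.
    have e : ((k : ℂ) - n / 2) * (k - 1 - 2 * (n / 2)) - 3 / 2 * (k - n / 2) ^ 2 =
        -(n * (3 * n + 4)) / 8 := by
      rcases hk with rfl | rfl
      · push_cast
        ring
      · push_cast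
        ring
    rw [e] at h1
    refine h1.congr ?_
    -- The north pole is avoided on a punctured neighbourhood, so only the branch of `entropy` using
    -- $G$ matters, even when $z$ is a pole of $G$.
    filter_upwards [hN] with w hw
    simp only [entropy, if_neg hw]
    rfl
  refine ⟨_, rfl, h2, ?_⟩
  have h3 := hasLeadingTerm_nabla 2 h2 hγ
  have h5 := hasLeadingTerm_nabla 4 (hasLeadingTerm_nabla 3 h3 hγ) hγ
  have e3 : HasLeadingTerm (entropy Y 3) z (-3) _ := h3
  have e5 : HasLeadingTerm (entropy Y 5) z (-5) _ := h5
  constructor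
  · convert e3 using 1
    push_cast
    ring
  · convert e5 using 1
    push_cast
    ring

/-- The coefficient of a relation of degree five is determined by the order of a zero of the Hopf
differential. -/
theorem relation_coefficient (h : IsMinimalPatch Y U)
    (hconf : ∀ z ∈ U, ∃ c : ℝ, metric Y z = c • (1 : Matrix _ _ ℝ)) (hz : z ∈ U) {n : ℕ}
        (hn0 : n ≠ 0)
    (hn : analyticOrderAt (hopf Y) z = n) {c : ℂ}
    (hrel : ∀ w ∈ U, hopf Y w ≠ 0 → entropy Y 5 w = c * (entropy Y 3 w * entropy Y 2 w)) :
    c = -(24 * ((n : ℂ) + 2) ^ 2 / ((3 * (n : ℂ) + 4) * (n : ℂ))) := by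
  obtain ⟨b, hb, h2, h3, h5⟩ := h.hasLeadingTerm_entropy hconf hz hn
  obtain ⟨a, ha, hq⟩ := HasLeadingTerm.of_analyticOrderAt (h.analyticAt_hopf hconf hz) hn
  have h6 : HasLeadingTerm (entropy Y 5) z (-5) _ := ((h3.mul h2).const_mul c).congr (by
    filter_upwards [hq.eventually_ne_zero ha,
      (h.isOpen.eventually_mem hz).filter_mono nhdsWithin_le_nhds] with w hw hU
    exact hrel w hU hw)
  have h7 := h5.unique h6
  have hn1 : (n : ℂ) ≠ 0 := by exact_mod_cast hn0
  have hn2 : (n : ℂ) + 2 ≠ 0 := by exact_mod_cast (by omega : n + 2 ≠ 0)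
  have hn4 : 3 * (n : ℂ) + 4 ≠ 0 := by exact_mod_cast (by omega : 3 * n + 4 ≠ 0)
  have hb0 : b ≠ 0 := by
    rw [hb]
    exact div_ne_zero (neg_ne_zero.2 (mul_ne_zero hn1 hn4)) (by norm_num)
  -- The $-5$ coefficients give $-3(n+2)^3b=-c(n+2)b^2$; cancel $-(n+2)b$, nonzero because $n\ne0$.
  have h8 : c * b = 3 * ((n : ℂ) + 2) ^ 2 := by
    apply mul_left_cancel₀ (mul_ne_zero hn2 hb0)
    linear_combination h7
  rw [← neg_div, eq_div_iff (mul_ne_zero hn4 hn1)]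
  rw [hb] at h8
  linear_combination -8 * h8

end IsMinimalPatch

/-! ### Change of coordinates -/

theorem det_clm_complex (L : ℂ →L[ℝ] ℂ) :
    L.det = (L 1).re * (L Complex.I).im - (L Complex.I).re * (L 1).im := by
  rw [ContinuousLinearMap.det, ← LinearMap.det_toMatrix Complex.basisOneI, Matrix.det_fin_two]
  simp [LinearMap.toMatrix_apply]

theorem clm_apply_eq {F : Type*} [NormedAddCommGroup F] [NormedSpace ℝ F] (D : ℂ →L[ℝ] F) (w : ℂ) :
    D w = w.re • D 1 + w.im • D Complex.I := by
  rw [← map_smul, ← map_smul, ← map_add]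
  congr 1
  apply Complex.ext <;> simp

/-- The Jacobian matrix of a map of the coordinate plane. -/
def jacobian (φ : ℂ → ℂ) (z : ℂ) : Matrix (Fin 2) (Fin 2) ℝ :=
  !![(pd 0 φ z).re, (pd 1 φ z).re; (pd 0 φ z).im, (pd 1 φ z).im]

theorem det_jacobian (φ : ℂ → ℂ) (z : ℂ) : (jacobian φ z).det = (fderiv ℝ φ z).det := by
  rw [det_clm_complex, jacobian, Matrix.det_fin_two_of]
  rfl

section Composition

variable {φ : ℂ → ℂ} {Y : ℂ → E3} {z : ℂ}

theorem pd_comp (hφ : DifferentiableAt ℝ φ z) (hY : DifferentiableAt ℝ Y (φ z)) (i : Fin 2) :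
    pd i (Y ∘ φ) z = jacobian φ z 0 i • pd 0 Y (φ z) + jacobian φ z 1 i • pd 1 Y (φ z) := by
  rw [pd, fderiv_comp z hY hφ, ContinuousLinearMap.comp_apply, clm_apply_eq]
  fin_cases i <;> rfl

theorem cross_pd_comp (hφ : DifferentiableAt ℝ φ z) (hY : DifferentiableAt ℝ Y (φ z)) :
    cross (pd 0 (Y ∘ φ) z) (pd 1 (Y ∘ φ) z) =
      (jacobian φ z).det • cross (pd 0 Y (φ z)) (pd 1 Y (φ z)) := by
  rw [pd_comp hφ hY, pd_comp hφ hY, Matrix.det_fin_two]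
  apply E3.ext_three <;>
    simp only [PiLp.add_apply, PiLp.smul_apply, smul_eq_mul, cross_apply_zero, cross_apply_one,
      cross_apply_two] <;> ring

theorem normal_comp (hφ : DifferentiableAt ℝ φ z) (hY : DifferentiableAt ℝ Y (φ z))
    (hd : 0 < (jacobian φ z).det) : normal (Y ∘ φ) z = normal Y (φ z) := by
  rw [normal, cross_pd_comp hφ hY, norm_smul, Real.norm_of_nonneg hd.le, smul_smul, mul_inv,
    mul_right_comm, inv_mul_cancel₀ hd.ne', one_mul, normal]

/-- Both forms pull back as $J^{\mathsf T}(\cdot)J$, so $g^{-1}A$ is conjugated by $J$. Positivity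
of the determinant keeps the normal from changing sign; it is required nearby because $A$
differentiates the normal. -/
theorem shape_comp (h : ∀ᶠ w in 𝓝 z, DifferentiableAt ℝ φ w ∧ DifferentiableAt ℝ Y (φ w) ∧
      0 < (fderiv ℝ φ w).det) (hN : DifferentiableAt ℝ (normal Y) (φ z)) :
    shape (Y ∘ φ) z = (jacobian φ z)⁻¹ * shape Y (φ z) * jacobian φ z ∧
      IsUnit (jacobian φ z).det := by
  obtain ⟨hφ, hY, hd⟩ := h.self_of_nhds
  rw [← det_jacobian] at hd
  have hu : IsUnit (jacobian φ z).det := isUnit_iff_ne_zero.2 hd.ne'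
  have hnormal : normal (Y ∘ φ) =ᶠ[𝓝 z] normal Y ∘ φ := by
    filter_upwards [h] with w hw
    exact normal_comp hw.1 hw.2.1 ((det_jacobian φ w).symm ▸ hw.2.2)
  have hg : metric (Y ∘ φ) z = (jacobian φ z).transpose * metric Y (φ z) * jacobian φ z := by
    ext i j
    simp only [metric, Matrix.of_apply, pd_comp hφ hY, Matrix.mul_apply, Fin.sum_univ_two,
      Matrix.transpose_apply, inner_add_left, inner_add_right, real_inner_smul_left,
      real_inner_smul_right]
    ring
  have hA : secondForm (Y ∘ φ) z =
      (jacobian φ z).transpose * secondForm Y (φ z) * jacobian φ z := by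
    ext i j
    simp only [secondForm, Matrix.of_apply, pd_congr _ hnormal, pd_comp hφ hY, pd_comp hφ hN,
      Matrix.mul_apply, Fin.sum_univ_two, Matrix.transpose_apply, inner_add_left, inner_add_right,
      real_inner_smul_left, real_inner_smul_right]
    ring
  refine ⟨?_, hu⟩
  have hu' : IsUnit (jacobian φ z).transpose.det := by rwa [Matrix.det_transpose]
  rw [shape, hg, hA, Matrix.mul_inv_rev, Matrix.mul_inv_rev, shape]
  simp only [Matrix.mul_assoc]
  rw [Matrix.nonsing_inv_mul_cancel_left _ _ hu']

end Composition

theorem trace_conj {P S : Matrix (Fin 2) (Fin 2) ℝ} (h : IsUnit P.det) :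
    (P⁻¹ * S * P).trace = S.trace := by
  rw [Matrix.trace_mul_cycle, Matrix.mul_nonsing_inv _ h, one_mul]

theorem conj_eq_smul_one_iff {P S : Matrix (Fin 2) (Fin 2) ℝ} (h : IsUnit P.det) (κ : ℝ) :
    P⁻¹ * S * P = κ • (1 : Matrix _ _ ℝ) ↔ S = κ • (1 : Matrix _ _ ℝ) := by
  constructor
  · intro h1
    have h2 : P * (P⁻¹ * S * P) * P⁻¹ = S := by
      rw [Matrix.mul_assoc P⁻¹, Matrix.mul_nonsing_inv_cancel_left _ _ h, Matrix.mul_assoc,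
        Matrix.mul_nonsing_inv _ h, mul_one]
    rw [← h2, h1]
    simp [Matrix.mul_nonsing_inv _ h]
  · rintro rfl
    simp [Matrix.nonsing_inv_mul _ h]

/-! ### Isothermal coordinates on a minimal patch -/

theorem bilin_symm_of_basis {B : ℂ →L[ℝ] ℂ →L[ℝ] ℝ} (h : B 1 Complex.I = B Complex.I 1) (x y : ℂ) :
    B x y = B y x := by
  rw [clm_apply_eq B x, clm_apply_eq B y]
  simp only [add_apply, smul_apply]
  rw [clm_apply_eq (B 1) y, clm_apply_eq (B 1) x, clm_apply_eq (B Complex.I) y,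
    clm_apply_eq (B Complex.I) x, h]
  simp only [smul_eq_mul]
  ring

namespace IsMinimalPatch

variable {Y : ℂ → E3} {U : Set ℂ} {z : ℂ}

/-- The conjugate form `(N × a) · dY` has a local potential. -/
theorem exists_potential (h : IsMinimalPatch Y U) (a : E3) {B : Set ℂ} (hB : IsOpen B)
    (hBc : Convex ℝ B) (hBU : B ⊆ U) :
    ∃ u : ℂ → ℝ, ContDiffOn ℝ ∞ u B ∧
      ∀ w ∈ B, ∀ i, pd i u w = ⟪cross (normal Y w) a, pd i Y w⟫ := by
  set β : ℂ → ℂ →L[ℝ] ℝ := fun w => (innerSL ℝ (cross (normal Y w) a)).comp (fderiv ℝ Y w) with hβ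
  have hY : ContDiffOn ℝ ∞ Y B := h.contDiffOn.mono hBU
  have hN : ContDiffOn ℝ ∞ (normal Y) B := h.contDiffOn_normal.mono hBU
  have hc : ContDiffOn ℝ ∞ (fun w => cross (normal Y w) a) B := contDiffOn_cross hN contDiffOn_const
  have hβs : ContDiffOn ℝ ∞ β B :=
    ((innerSL ℝ).contDiff.comp_contDiffOn hc).clm_comp (hY.fderiv_of_isOpen hB (by simp))
  have hβd : DifferentiableOn ℝ β B := hβs.differentiableOn (by simp)
  have hsymm : ∀ w ∈ B, ∀ x y, fderiv ℝ β w x y = fderiv ℝ β w y x := by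
    intro w hw
    have hwU := hBU hw
    have hcw : DifferentiableAt ℝ (fun w => cross (normal Y w) a) w :=
      (hc.contDiffAt (hB.mem_nhds hw)).differentiableAt (by simp)
    have hij (i j : Fin 2) : fderiv ℝ β w (dir i) (dir j) =
        ⟪cross (pd i (normal Y) w) a, pd j Y w⟫ +
          ⟪cross (normal Y w) a, pd i (pd j Y) w⟫ := by
      have h1 : pd i (fun w => β w (dir j)) w = fderiv ℝ β w (dir i) (dir j) := by
        rw [pd, fderiv_clm_apply (hβd.differentiableAt (hB.mem_nhds hw)) (differentiableAt_const _)]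
        simp
      have h2 : pd i (fun w => cross (normal Y w) a) w = cross (pd i (normal Y) w) a := by
        rw [pd_cross (h.differentiableAt_normal hwU) (differentiableAt_const a)]
        simp [pd, cross]
      rw [← h1, ← h2]
      exact pd_inner hcw (h.differentiableAt_pd hwU j) i
    apply bilin_symm_of_basis
    have h01 := hij 0 1
    have h10 := hij 1 0
    simp only [dir, Matrix.cons_val_zero, Matrix.cons_val_one] at h01 h10
    rw [h01, h10, pd_comm ((h.contDiffOn.contDiffAt (h.isOpen.mem_nhds hwU)).of_le
      (by norm_cast)) 1 0]
    congr 1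
    -- What remains of the antisymmetric part is the pairing of $a$ with $N_x\times Y_y-N_y\times
    -- Y_x=0$.
    rw [cross_anticomm, inner_neg_left, inner_cross_rotate, h.cross_pd_normal hwU,
      cross_anticomm _ a, inner_neg_left, inner_cross_rotate]
  obtain ⟨u, hu⟩ := hBc.exists_forall_hasFDerivAt_of_fderiv_symmetric hB hβd hsymm
  refine ⟨u, ?_, fun w hw i => ?_⟩
  · rw [contDiffOn_infty_iff_fderiv_of_isOpen hB]
    exact ⟨fun w hw => (hu w hw).differentiableAt.differentiableWithinAt,
      hβs.congr fun w hw => (hu w hw).fderiv⟩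
  · rw [pd, (hu w hw).fderiv]
    rfl

theorem cross_eq_norm_smul_normal (h : IsMinimalPatch Y U) (hz : z ∈ U) :
    cross (pd 0 Y z) (pd 1 Y z) = ‖cross (pd 0 Y z) (pd 1 Y z)‖ • normal Y z := by
  rw [normal, smul_smul, mul_inv_cancel₀ (norm_ne_zero_iff.2 (h.cross_ne z hz)), one_smul]

/-- Existence of isothermal coordinates near a point of a minimal patch. -/
theorem exists_isothermal (h : IsMinimalPatch Y U) (hz : z ∈ U) :
    ∃ f : OpenPartialHomeomorph ℂ ℂ, z ∈ f.source ∧ f.source ⊆ U ∧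
      ContDiffOn ℝ ∞ f f.source ∧ ContDiffOn ℝ ∞ f.symm f.target ∧
      (∀ w ∈ f.source, 0 < (fderiv ℝ f w).det) ∧
      ∀ w ∈ f.target, ∃ c : ℝ, metric (Y ∘ f.symm) w = c • (1 : Matrix _ _ ℝ) := by
  obtain ⟨r, hr, hBU⟩ := Metric.isOpen_iff.1 h.isOpen z hz
  set B := Metric.ball z r with hB
  set a := pd 0 Y z with ha
  obtain ⟨u, hus, hu⟩ := h.exists_potential a Metric.isOpen_ball (convex_ball z r) hBU
  -- The coordinate is a linear function of the surface plus $i$ times its conjugate. On tangent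
  -- vectors $v$ it satisfies $|dF(v)|^2=(|a|^2-\langle N,a\rangle^2)\,|dY(v)|^2$, hence is
  -- conformal; taking $a=Y_x(z)$, tangent at $z$, makes the factor positive there.
  set F : ℂ → ℂ := fun w => (⟪a, Y w⟫ : ℂ) + Complex.I * (u w : ℂ) with hF
  have hY : ContDiffOn ℝ ∞ Y B := h.contDiffOn.mono hBU
  have hFs : ContDiffOn ℝ ∞ F B :=
    (Complex.ofRealCLM.contDiff.comp_contDiffOn (contDiffOn_const.inner ℝ hY)).add
      (contDiffOn_const.mul (Complex.ofRealCLM.contDiff.comp_contDiffOn hus))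
  have hFd : ∀ w ∈ B, DifferentiableAt ℝ F w := fun w hw =>
    (hFs.contDiffAt (Metric.isOpen_ball.mem_nhds hw)).differentiableAt (by simp)
  have hre (w : ℂ) : (F w).re = ⟪a, Y w⟫ := by simp [hF]
  have him (w : ℂ) : (F w).im = u w := by simp [hF]
  have hpre : ∀ w ∈ B, ∀ i, (pd i F w).re = ⟪a, pd i Y w⟫ := by
    intro w hw i
    rw [← Complex.reCLM_apply, ← pd_clm_comp Complex.reCLM (hFd w hw)]
    simp only [Complex.reCLM_apply, hre]
    rw [pd_inner (differentiableAt_const a) (h.differentiableAt (hBU hw))]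
    simp [pd]
  have hpim : ∀ w ∈ B, ∀ i, (pd i F w).im = ⟪cross (normal Y w) a, pd i Y w⟫ := by
    intro w hw i
    rw [← Complex.imCLM_apply, ← pd_clm_comp Complex.imCLM (hFd w hw)]
    simp only [Complex.imCLM_apply, him]
    exact hu w hw i
  have hdet : ∀ w ∈ B, (fderiv ℝ F w).det =
      ‖cross (pd 0 Y w) (pd 1 Y w)‖ * (⟪a, a⟫ - ⟪normal Y w, a⟫ ^ 2) := by
    intro w hw
    have h1 : (fderiv ℝ F w).det = ⟪cross a (cross (normal Y w) a), cross (pd 0 Y w) (pd 1 Y w)⟫ :=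
        by
      rw [inner_cross_cross, ← hpre w hw, ← hpre w hw, ← hpim w hw, ← hpim w hw, det_clm_complex]
      rfl
    have hW := h.cross_eq_norm_smul_normal (hBU hw)
    rw [h1]
    generalize ‖cross (pd 0 Y w) (pd 1 Y w)‖ = ν at hW ⊢
    rw [hW, inner_smul_right, cross_anticomm, cross_cross, inner_neg_left, inner_sub_left,
      inner_smul_left, inner_smul_left, h.inner_normal_normal (hBU hw),
      real_inner_comm (normal Y w) a]
    simp only [conj_trivial]
    ring
  have ha0 : 0 < ⟪a, a⟫ := by
    rw [real_inner_self_eq_norm_sq]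
    have : a ≠ 0 := fun h0 => h.cross_ne z hz (by rw [← ha, h0]; simp [cross])
    positivity
  -- Restricting the local inverse to this open set gives orientation, smoothness of the inverse and
  -- nonvanishing of the conformal factor at every point.
  set V : Set ℂ := {w ∈ B | 0 < (fderiv ℝ F w).det} with hV
  have hVo : IsOpen V := by
    have hc : ContinuousOn (fun w => (fderiv ℝ F w).det) B :=
      ContinuousLinearMap.continuous_det.comp_continuousOn
        (hFs.continuousOn_fderiv_of_isOpen Metric.isOpen_ball (by simp))
    exact hc.isOpen_inter_preimage Metric.isOpen_ball isOpen_Ioi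
  have hVB : V ⊆ B := fun w hw => hw.1
  have hzB : z ∈ B := Metric.mem_ball_self hr
  have hzV : z ∈ V := by
    refine ⟨hzB, ?_⟩
    rw [hdet z hzB, inner_normal_pd]
    have := norm_pos_iff.2 (h.cross_ne z hz)
    rw [zero_pow two_ne_zero, sub_zero]
    positivity
  have hequiv : ∀ w ∈ V, ∃ L : ℂ ≃L[ℝ] ℂ, HasFDerivAt F (L : ℂ →L[ℝ] ℂ) w := by
    intro w hw
    refine ⟨ContinuousLinearMap.toContinuousLinearEquivOfDetNeZero (fderiv ℝ F w) hw.2.ne', ?_⟩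
    rw [ContinuousLinearMap.coe_toContinuousLinearEquivOfDetNeZero]
    exact (hFd w hw.1).hasFDerivAt
  have hcd : ∀ w ∈ V, ContDiffAt ℝ ∞ F w := fun w hw =>
    hFs.contDiffAt (Metric.isOpen_ball.mem_nhds hw.1)
  obtain ⟨L, hL⟩ := hequiv z hzV
  set f₀ := (hcd z hzV).toOpenPartialHomeomorph F hL (by simp) with hf₀
  set f := f₀.restrOpen V hVo with hf
  have hsrc : f.source ⊆ V := fun w hw => hw.2
  have hsymm : ContDiffOn ℝ ∞ f.symm f.target := by
    intro w hw
    obtain ⟨L', hL'⟩ := hequiv _ (hsrc (f.map_target hw))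
    exact (f.contDiffAt_symm hw hL' (hcd _ (hsrc (f.map_target hw)))).contDiffWithinAt
  refine ⟨f, ⟨ContDiffAt.mem_toOpenPartialHomeomorph_source _ hL _, hzV⟩,
    hsrc.trans (hVB.trans hBU), hFs.mono (hsrc.trans hVB), hsymm, fun w hw => (hsrc hw).2, ?_⟩
  intro w hw
  set x := f.symm w with hx
  have hxV : x ∈ V := hsrc (f.map_target hw)
  have hxU : x ∈ U := hBU hxV.1
  have hfs : DifferentiableAt ℝ f.symm w :=
    (hsymm.contDiffAt (f.open_target.mem_nhds hw)).differentiableAt (by simp)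
  set μ := ⟪a, a⟫ - ⟪normal Y x, a⟫ ^ 2 with hμ
  have hμ0 : μ ≠ 0 := by
    intro h0
    have := hxV.2
    rw [hdet x hxV.1, ← hμ, h0, mul_zero] at this
    exact lt_irrefl _ this
  set E := fderiv ℝ f.symm w with hE
  have hDE (s : ℂ) : fderiv ℝ F x (E s) = s := by
    have h1 : (F ∘ f.symm) =ᶠ[𝓝 w] id :=
      eventually_of_mem (f.open_target.mem_nhds hw) fun y hy => f.right_inv hy
    have h2 := fderiv_comp w (hFd x hxV.1) hfs
    rw [h1.fderiv_eq, fderiv_id] at h2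
    exact (congrArg (fun T : ℂ →L[ℝ] ℂ => T s) h2).symm
  have hnorm (v : ℂ) : ‖fderiv ℝ F x v‖ ^ 2 = μ * ⟪fderiv ℝ Y x v, fderiv ℝ Y x v⟫ := by
    have e1 : fderiv ℝ Y x v = v.re • pd 0 Y x + v.im • pd 1 Y x := clm_apply_eq _ v
    have e2 : fderiv ℝ F x v = v.re • pd 0 F x + v.im • pd 1 F x := clm_apply_eq _ v
    have hp : ⟪normal Y x, fderiv ℝ Y x v⟫ = 0 := by
      rw [e1, inner_add_right, inner_smul_right, inner_smul_right, inner_normal_pd,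
        inner_normal_pd]
      simp
    have r1 : (fderiv ℝ F x v).re = ⟪a, fderiv ℝ Y x v⟫ := by
      rw [e1, e2, inner_add_right, inner_smul_right, inner_smul_right, ← hpre x hxV.1,
        ← hpre x hxV.1]
      simp
    have r2 : (fderiv ℝ F x v).im = ⟪cross (normal Y x) a, fderiv ℝ Y x v⟫ := by
      rw [e1, e2, inner_add_right, inner_smul_right, inner_smul_right, ← hpim x hxV.1,
        ← hpim x hxV.1]
      simp
    have := inner_cross_sq (normal Y x) a (fderiv ℝ Y x v)
    rw [h.inner_normal_normal hxU, hp] at this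
    rw [← Complex.normSq_eq_norm_sq, Complex.normSq_apply, r1, r2, hμ]
    linear_combination this
  have hT (s : ℂ) : fderiv ℝ (Y ∘ f.symm) w s = fderiv ℝ Y x (E s) := by
    rw [fderiv_comp w (h.differentiableAt hxU) hfs]
    rfl
  set T := fderiv ℝ (Y ∘ f.symm) w with hTdef
  have hTn (s : ℂ) : ⟪T s, T s⟫ = μ⁻¹ * ‖s‖ ^ 2 := by
    have := hnorm (E s)
    rw [hDE] at this
    rw [hT, this, inv_mul_cancel_left₀ hμ0]
  have t0 := hTn 1
  -- The pulled-back metric is $\mu^{-1}|s|^2$ as a quadratic form; the off-diagonal entry follows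
  -- by polarisation with $s=1+i$.
  have t1 := hTn Complex.I
  have t2 := hTn (1 + Complex.I)
  have hn2 : ‖(1 : ℂ) + Complex.I‖ ^ 2 = 2 := by
    rw [← Complex.normSq_eq_norm_sq, Complex.normSq_apply]
    norm_num
  rw [hn2, map_add, inner_add_left, inner_add_right, inner_add_right,
    real_inner_comm (T 1) (T Complex.I)] at t2
  simp only [norm_one, Complex.norm_I, one_pow, mul_one] at t0 t1
  rw [t0, t1] at t2
  have t3 : ⟪T 1, T Complex.I⟫ = 0 := by linarith
  have t3' : ⟪T Complex.I, T 1⟫ = 0 := by rw [real_inner_comm]; exact t3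
  rw [real_inner_self_eq_norm_sq] at t0 t1
  refine ⟨μ⁻¹, ?_⟩
  ext i j
  fin_cases i <;> fin_cases j <;>
    simp [metric, pd, dir, ← hTdef, t0, t1, t3, t3']

end IsMinimalPatch

/-! ### Oriented charts of a minimal surface -/

theorem mem_contDiffGroupoid_iff {f : OpenPartialHomeomorph ℂ ℂ} :
    f ∈ contDiffGroupoid ∞ 𝓘(ℝ, ℂ) ↔
      ContDiffOn ℝ ∞ f f.source ∧ ContDiffOn ℝ ∞ f.symm f.target := by
  rw [contDiffGroupoid, mem_groupoid_of_pregroupoid]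
  simp [contDiffPregroupoid]

/-- If the cross product vanishes, so does the Gram determinant, and equality in Cauchy–Schwarz
yields the kernel vector $|L i|^2\cdot 1-\langle L1,Li\rangle\, i$. -/
theorem cross_ne_zero_of_injective {L : ℂ →L[ℝ] E3} (hL : Function.Injective L) :
    cross (L 1) (L Complex.I) ≠ 0 := by
  intro h0
  have h1 := inner_cross_cross (L 1) (L Complex.I) (L 1) (L Complex.I)
  rw [h0, inner_zero_left, real_inner_comm (L 1) (L Complex.I)] at h1
  set α := ⟪L Complex.I, L Complex.I⟫ with hα
  set β := ⟪L 1, L Complex.I⟫ with hβ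
  have h2 : L (α • (1 : ℂ) - β • Complex.I) = 0 := by
    rw [← inner_self_eq_zero (𝕜 := ℝ)]
    simp only [map_sub, map_smul, inner_sub_left, inner_sub_right, real_inner_smul_left,
      real_inner_smul_right, real_inner_comm (L 1) (L Complex.I), ← hα, ← hβ]
    linear_combination -α * h1
  have h3 := (map_eq_zero_iff L hL).1 h2
  have h4 : α = 0 := by simpa using congrArg Complex.re h3
  exact Complex.I_ne_zero ((map_eq_zero_iff L hL).1 (inner_self_eq_zero.1 h4))

section Surface

variable {M : Type*} [TopologicalSpace M] [ChartedSpace ℂ M]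

/-- A smooth, positively oriented chart. -/
structure IsOrientedChart (e : OpenPartialHomeomorph M ℂ) : Prop where
  smooth : e ∈ IsManifold.maximalAtlas 𝓘(ℝ, ℂ) ∞ M
  oriented : ∀ e' ∈ atlas ℂ M, ∀ p ∈ e'.source ∩ e.source,
    0 < (fderiv ℝ (e ∘ e'.symm) (e' p)).det

theorem IsHolomorphicCoordinate.isOrientedChart {X : M → E3} {e : OpenPartialHomeomorph M ℂ}
    (he : IsHolomorphicCoordinate X e) : IsOrientedChart e :=
  ⟨he.smooth, he.oriented⟩

theorem isOrientedChart_of_mem_atlas [IsManifold 𝓘(ℝ, ℂ) ∞ M] [OrientedAtlas M]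
    {e : OpenPartialHomeomorph M ℂ}
    (he : e ∈ atlas ℂ M) : IsOrientedChart e :=
  ⟨IsManifold.subset_maximalAtlas he, fun e' he' p hp => OrientedAtlas.det_pos e' he' e he p hp⟩

theorem contDiffOn_transition {e e' : OpenPartialHomeomorph M ℂ}
    (he : e ∈ IsManifold.maximalAtlas 𝓘(ℝ, ℂ) ∞ M)
    (he' : e' ∈ IsManifold.maximalAtlas 𝓘(ℝ, ℂ) ∞ M) :
    ContDiffOn ℝ ∞ (e' ∘ e.symm) (e.symm ≫ₕ e').source :=
  (mem_contDiffGroupoid_iff.1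
    ((contDiffGroupoid ∞ 𝓘(ℝ, ℂ)).compatible_of_mem_maximalAtlas he he')).1

theorem differentiableAt_transition {e e' : OpenPartialHomeomorph M ℂ}
    (he : e ∈ IsManifold.maximalAtlas 𝓘(ℝ, ℂ) ∞ M)
    (he' : e' ∈ IsManifold.maximalAtlas 𝓘(ℝ, ℂ) ∞ M) {z : ℂ} (hz : z ∈ (e.symm ≫ₕ e').source) :
    DifferentiableAt ℝ (e' ∘ e.symm) z :=
  ((contDiffOn_transition he he').contDiffAt
    ((e.symm ≫ₕ e').open_source.mem_nhds hz)).differentiableAt (by simp)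

theorem det_comp_fderiv {f g : ℂ → ℂ} {z : ℂ} (hf : DifferentiableAt ℝ f (g z))
    (hg : DifferentiableAt ℝ g z) :
    (fderiv ℝ (f ∘ g) z).det = (fderiv ℝ f (g z)).det * (fderiv ℝ g z).det := by
  rw [fderiv_comp z hf hg]
  exact LinearMap.det_comp _ _

namespace IsOrientedChart

variable {e : OpenPartialHomeomorph M ℂ} {z : ℂ}

/-- The field `oriented` controls the opposite transition; the two Jacobian determinants multiply to
$1$. -/
theorem det_transition_pos [IsManifold 𝓘(ℝ, ℂ) ∞ M] (he : IsOrientedChart e)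
    {e' : OpenPartialHomeomorph M ℂ}
    (he' : e' ∈ atlas ℂ M) (hz : z ∈ (e.symm ≫ₕ e').source) :
    0 < (fderiv ℝ (e' ∘ e.symm) z).det := by
  have hm := IsManifold.subset_maximalAtlas (I := 𝓘(ℝ, ℂ)) (n := ∞) he'
  have hz1 : z ∈ e.target := hz.1
  have hz2 : e.symm z ∈ e'.source := hz.2
  have h1 := he.oriented e' he' (e.symm z) ⟨hz2, e.map_target hz1⟩
  have hφ := differentiableAt_transition he.smooth hm hz
  have hψ : DifferentiableAt ℝ (e ∘ e'.symm) ((e' ∘ e.symm) z) := by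
    apply differentiableAt_transition hm he.smooth
    refine ⟨e'.map_source hz2, ?_⟩
    change e'.symm (e' (e.symm z)) ∈ e.source
    rw [e'.left_inv hz2]
    exact e.map_target hz1
  have h2 : (e ∘ e'.symm) ∘ (e' ∘ e.symm) =ᶠ[𝓝 z] id := by
    filter_upwards [(e.symm ≫ₕ e').open_source.mem_nhds hz] with w hw
    have hw2 : e.symm w ∈ e'.source := hw.2
    simp [e'.left_inv hw2, e.right_inv hw.1]
  have h3 := det_comp_fderiv hψ hφ
  rw [h2.fderiv_eq, fderiv_id] at h3
  have h4 : (ContinuousLinearMap.id ℝ ℂ).det = 1 := LinearMap.det_id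
  rw [h4] at h3
  exact (pos_iff_pos_of_mul_pos (h3 ▸ one_pos)).1 h1

variable {X : M → E3}

theorem contDiffOn_comp_symm (he : IsOrientedChart e) (hX : IsMinimalImmersion X) :
    ContDiffOn ℝ ∞ (X ∘ e.symm) e.target := by
  rw [← contMDiffOn_iff_contDiffOn]
  exact hX.smooth.comp_contMDiffOn (contMDiffOn_symm_of_mem_maximalAtlas he.smooth)

theorem cross_ne (he : IsOrientedChart e) (hX : IsMinimalImmersion X) (hz : z ∈ e.target) :
    cross (pd 0 (X ∘ e.symm) z) (pd 1 (X ∘ e.symm) z) ≠ 0 := by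
  have hd : e.MDifferentiable 𝓘(ℝ, ℂ) 𝓘(ℝ, ℂ) :=
    ⟨(contMDiffOn_of_mem_maximalAtlas he.smooth).mdifferentiableOn (by simp),
      (contMDiffOn_symm_of_mem_maximalAtlas he.smooth).mdifferentiableOn (by simp)⟩
  have h1 : mfderiv 𝓘(ℝ, ℂ) 𝓘(ℝ, E3) (X ∘ e.symm) z =
      (mfderiv 𝓘(ℝ, ℂ) 𝓘(ℝ, E3) X (e.symm z)).comp (mfderiv 𝓘(ℝ, ℂ) 𝓘(ℝ, ℂ) e.symm z) :=
    mfderiv_comp z ((hX.smooth _).mdifferentiableAt (by simp)) (hd.mdifferentiableAt_symm hz)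
  have h2 : Function.Injective (mfderiv 𝓘(ℝ, ℂ) 𝓘(ℝ, E3) (X ∘ e.symm) z) := by
    rw [h1]
    exact (hX.immersion _).comp (hd.symm.mfderiv_injective hz)
  rw [mfderiv_eq_fderiv] at h2
  exact cross_ne_zero_of_injective h2

/-- The shape operators in two charts are conjugate. -/
theorem exists_shape_eq [IsManifold 𝓘(ℝ, ℂ) ∞ M] [OrientedAtlas M] (he : IsOrientedChart e)
    (hX : IsMinimalImmersion X)
    (hz : z ∈ e.target) : ∃ P : Matrix (Fin 2) (Fin 2) ℝ, IsUnit P.det ∧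
      shape (X ∘ e.symm) z = P⁻¹ * shapeAt X (e.symm z) * P := by
  set e' := chartAt ℂ (e.symm z) with he'def
  have hatlas : e' ∈ atlas ℂ M := chart_mem_atlas ℂ _
  have he' := isOrientedChart_of_mem_atlas hatlas
  have hsrc : e.symm z ∈ e'.source := mem_chart_source ℂ _
  have hzs : z ∈ (e.symm ≫ₕ e').source := ⟨hz, hsrc⟩
  have hY : X ∘ e.symm =ᶠ[𝓝 z] (X ∘ e'.symm) ∘ (e' ∘ e.symm) := by
    filter_upwards [(e.symm ≫ₕ e').open_source.mem_nhds hzs] with w hw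
    have hw2 : e.symm w ∈ e'.source := hw.2
    simp [e'.left_inv hw2]
  have hs := he'.contDiffOn_comp_symm hX
  have hN := contDiffOn_normal e'.open_target hs fun w hw => he'.cross_ne hX hw
  have h := shape_comp (φ := e' ∘ e.symm) (Y := X ∘ e'.symm) (z := z) (by
      filter_upwards [(e.symm ≫ₕ e').open_source.mem_nhds hzs] with w hw
      have hw2 : e.symm w ∈ e'.source := hw.2
      exact ⟨differentiableAt_transition he.smooth he'.smooth hw,
        (hs.contDiffAt (e'.open_target.mem_nhds (e'.map_source hw2))).differentiableAt (by simp),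
        he.det_transition_pos hatlas hw⟩)
    ((hN.contDiffAt (e'.open_target.mem_nhds (e'.map_source hsrc))).differentiableAt (by simp))
  refine ⟨_, h.2, ?_⟩
  have h1 : shape (X ∘ e.symm) z = shape ((X ∘ e'.symm) ∘ (e' ∘ e.symm)) z := by
    have hpd (i) : pd i (X ∘ e.symm) =ᶠ[𝓝 z] pd i ((X ∘ e'.symm) ∘ (e' ∘ e.symm)) :=
      hY.eventuallyEq_nhds.mono fun w hw => pd_congr i hw
    have hn : normal (X ∘ e.symm) =ᶠ[𝓝 z] normal ((X ∘ e'.symm) ∘ (e' ∘ e.symm)) := by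
      filter_upwards [hpd 0, hpd 1] with w h0 h1
      rw [normal, normal, h0, h1]
    simp only [shape, metric, secondForm, pd_congr _ hn, pd_congr _ hY]
  rw [h1, h.1]
  rfl

theorem isMinimalPatch [IsManifold 𝓘(ℝ, ℂ) ∞ M] [OrientedAtlas M] (he : IsOrientedChart e)
    (hX : IsMinimalImmersion X) :
    IsMinimalPatch (X ∘ e.symm) e.target := by
  refine ⟨e.open_target, he.contDiffOn_comp_symm hX, fun z hz => he.cross_ne hX hz, ?_⟩
  intro z hz
  obtain ⟨P, hP, h⟩ := he.exists_shape_eq hX hz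
  rw [h, trace_conj hP]
  have := hX.minimal (e.symm z)
  rw [meanCurvature] at this
  linarith

theorem isUmbilic_iff [IsManifold 𝓘(ℝ, ℂ) ∞ M] [OrientedAtlas M] (he : IsOrientedChart e)
    (hX : IsMinimalImmersion X)
    (hz : z ∈ e.target) :
    IsUmbilic X (e.symm z) ↔ ∃ κ : ℝ, shape (X ∘ e.symm) z = κ • (1 : Matrix _ _ ℝ) := by
  obtain ⟨P, hP, h⟩ := he.exists_shape_eq hX hz
  rw [h]
  simp only [conj_eq_smul_one_iff hP]
  rfl

end IsOrientedChart

variable {X : M → E3}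

theorem IsHolomorphicCoordinate.isUmbilic_iff [IsManifold 𝓘(ℝ, ℂ) ∞ M] [OrientedAtlas M]
    {e : OpenPartialHomeomorph M ℂ}
    (he : IsHolomorphicCoordinate X e) (hX : IsMinimalImmersion X) {z : ℂ} (hz : z ∈ e.target) :
    IsUmbilic X (e.symm z) ↔ hopf (X ∘ e.symm) z = 0 := by
  rw [he.isOrientedChart.isUmbilic_iff hX hz,
    (he.isOrientedChart.isMinimalPatch hX).hopf_eq_zero_iff hz (he.conformal z hz)]

/-- Every point of a minimal surface has a holomorphic coordinate. -/
theorem exists_isHolomorphicCoordinate [IsManifold 𝓘(ℝ, ℂ) ∞ M] [OrientedAtlas M]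
    (hX : IsMinimalImmersion X) (p : M) :
    ∃ e : OpenPartialHomeomorph M ℂ, IsHolomorphicCoordinate X e ∧ p ∈ e.source := by
  set e₀ := chartAt ℂ p with he₀def
  have hatlas : e₀ ∈ atlas ℂ M := chart_mem_atlas ℂ p
  have he₀ := isOrientedChart_of_mem_atlas hatlas
  have hp : p ∈ e₀.source := mem_chart_source ℂ p
  obtain ⟨f, hpf, hfU, hf, hfs, hdet, hconf⟩ :=
    (he₀.isMinimalPatch hX).exists_isothermal (e₀.map_source hp)
  have hfG : f ∈ contDiffGroupoid ∞ 𝓘(ℝ, ℂ) := mem_contDiffGroupoid_iff.2 ⟨hf, hfs⟩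
  -- An atlas chart is oriented but need not be conformal, so it is followed by an isothermal
  -- coordinate of its patch.
  refine ⟨e₀ ≫ₕ f, ⟨?_, ?_, ?_⟩, ⟨hp, hpf⟩⟩
  · intro e' he'
    constructor
    · rw [OpenPartialHomeomorph.trans_symm_eq_symm_trans_symm, OpenPartialHomeomorph.trans_assoc]
      exact (contDiffGroupoid ∞ 𝓘(ℝ, ℂ)).trans ((contDiffGroupoid ∞ 𝓘(ℝ, ℂ)).symm hfG)
        (he₀.smooth e' he').1
    · rw [← OpenPartialHomeomorph.trans_assoc]
      exact (contDiffGroupoid ∞ 𝓘(ℝ, ℂ)).trans (he₀.smooth e' he').2 hfG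
  · rintro e' he' x ⟨hx', hx, hxf⟩
    have hxe : e'.symm (e' x) = x := e'.left_inv hx'
    have hx₀ : e₀ (e'.symm (e' x)) = e₀ x := by rw [hxe]
    have hxf' : e₀ x ∈ f.source := hxf
    have h1 : DifferentiableAt ℝ (e₀ ∘ e'.symm) (e' x) := by
      apply differentiableAt_transition (IsManifold.subset_maximalAtlas he') he₀.smooth
      refine ⟨e'.map_source hx', ?_⟩
      change e'.symm (e' x) ∈ e₀.source
      rw [hxe]
      exact hx
    have h2 : DifferentiableAt ℝ f ((e₀ ∘ e'.symm) (e' x)) := by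
      rw [Function.comp_apply, hx₀]
      exact (hf.contDiffAt (f.open_source.mem_nhds hxf')).differentiableAt (by simp)
    change 0 < (fderiv ℝ (f ∘ (e₀ ∘ e'.symm)) (e' x)).det
    rw [det_comp_fderiv h2 h1]
    refine mul_pos ?_ (OrientedAtlas.det_pos e' he' e₀ hatlas x ⟨hx', hx⟩)
    rw [Function.comp_apply, hx₀]
    exact hdet _ hxf'
  · rintro z ⟨hz, -⟩
    exact hconf z hz

theorem not_isUmbilic_of_gaussCurvature_ne_zero (hX : IsMinimalImmersion X) {p : M}
    (hp : gaussCurvature X p ≠ 0) : ¬ IsUmbilic X p := by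
  rintro ⟨κ, hκ⟩
  have h1 := hX.minimal p
  rw [meanCurvature, hκ, Matrix.trace_fin_two] at h1
  simp at h1
  apply hp
  rw [gaussCurvature, hκ, Matrix.det_fin_two]
  simp
  linarith

/-- The umbilic points of a connected non-flat minimal surface have empty interior. -/
theorem not_eventually_isUmbilic [IsManifold 𝓘(ℝ, ℂ) ∞ M] [OrientedAtlas M] [ConnectedSpace M]
    (hX : IsMinimalImmersion X) (hflat : NonFlat X)
    (p : M) : ¬ ∀ᶠ x in 𝓝 p, IsUmbilic X x := by
  -- The interior of the umbilic set is open by construction and closed by the identity theorem for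
  -- $q$ on a coordinate disc; were it nonempty, connectedness would make every point umbilic, hence
  -- $K\equiv0$.
  set S : Set M := {p | ∀ᶠ x in 𝓝 p, IsUmbilic X x} with hS
  have hopen : IsOpen S := isOpen_setOfPred_eventually_nhds
  have hclosed : IsClosed S := by
    rw [← closure_subset_iff_isClosed]
    intro y hy
    obtain ⟨e, he, hye⟩ := exists_isHolomorphicCoordinate hX y
    obtain ⟨r, hr, hB⟩ := Metric.isOpen_iff.1 e.open_target (e y) (e.map_source hye)
    have hW : e.source ∩ e ⁻¹' Metric.ball (e y) r ∈ 𝓝 y :=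
      inter_mem (e.open_source.mem_nhds hye)
        (e.continuousAt hye (Metric.ball_mem_nhds _ hr))
    obtain ⟨x, ⟨hxe, hxB⟩, hxS⟩ := mem_closure_iff_nhds.1 hy _ hW
    have han : AnalyticOnNhd ℂ (hopf (X ∘ e.symm)) (Metric.ball (e y) r) := fun z hz =>
      (he.isOrientedChart.isMinimalPatch hX).analyticAt_hopf he.conformal (hB hz)
    have hzero : hopf (X ∘ e.symm) =ᶠ[𝓝 (e x)] 0 := by
      have hc : ContinuousAt e.symm (e x) := e.symm.continuousAt (e.map_source hxe)
      have h1 : Tendsto e.symm (𝓝 (e x)) (𝓝 x) := by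
        have := hc.tendsto
        rwa [e.left_inv hxe] at this
      filter_upwards [h1.eventually hxS, e.open_target.mem_nhds (e.map_source hxe)] with w hw hwt
      exact (he.isUmbilic_iff hX hwt).1 hw
    have hall := han.eqOn_zero_of_preconnected_of_eventuallyEq_zero
      (convex_ball (e y) r).isPreconnected hxB hzero
    filter_upwards [hW] with w hw
    have hw1 : w ∈ e.source := hw.1
    rw [← e.left_inv hw1, he.isUmbilic_iff hX (e.map_source hw1)]
    exact hall hw.2
  intro hp
  obtain ⟨x, hx⟩ := hflat
  have huniv : S = Set.univ := (isClopen_iff.1 ⟨hclosed, hopen⟩).resolve_left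
    (Set.Nonempty.ne_empty ⟨p, hp⟩)
  have hxS : x ∈ S := huniv ▸ Set.mem_univ x
  exact not_isUmbilic_of_gaussCurvature_ne_zero hX hx hxS.self_of_nhds

/-- At an umbilic point of a connected non-flat minimal surface, the Hopf differential vanishes to
some finite order. -/
theorem exists_hopfVanishesToOrder [IsManifold 𝓘(ℝ, ℂ) ∞ M] [OrientedAtlas M] [ConnectedSpace M]
    (hX : IsMinimalImmersion X)
    (hflat : NonFlat X) (q : M) : ∃ m : ℕ, HopfVanishesToOrder X m q := by
  obtain ⟨e, he, hq⟩ := exists_isHolomorphicCoordinate hX q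
  have han := (he.isOrientedChart.isMinimalPatch hX).analyticAt_hopf he.conformal (e.map_source hq)
  have hfin : analyticOrderAt (hopf (X ∘ e.symm)) (e q) ≠ ⊤ := by
    intro htop
    rw [analyticOrderAt_eq_top] at htop
    apply not_eventually_isUmbilic hX hflat q
    filter_upwards [(e.continuousAt hq).eventually htop, e.open_source.mem_nhds hq] with x hx hxe
    rw [← e.left_inv hxe, he.isUmbilic_iff hX (e.map_source hxe)]
    exact hx
  obtain ⟨m, hm⟩ := ENat.ne_top_iff_exists.1 hfin
  exact ⟨m, e, he, hq, han, hm.symm⟩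

/-- The only weighted-homogeneous polynomials of degree five are the multiples of `P₂ P₃`. -/
theorem HasDegree.exists_coefficient (h : HasDegree X 5) :
    ∃ c : ℂ, ∀ e : OpenPartialHomeomorph M ℂ, IsHolomorphicCoordinate X e →
      ∀ z ∈ e.target, ¬ IsUmbilic X (e.symm z) →
        entropy (X ∘ e.symm) 5 z =
          c * (entropy (X ∘ e.symm) 3 z * entropy (X ∘ e.symm) 2 z) := by
  obtain ⟨-, h0 | ⟨ψ, -, hψ, hrel⟩⟩ := h
  · exact ⟨0, fun e he z hz hu => by rw [h0 e he z hz hu, zero_mul]⟩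
  -- The support contains at most one exponent, so this sum is just its coefficient.
  · refine ⟨∑ d ∈ ψ.support, ψ.coeff d, fun e he z hz hu => ?_⟩
    rw [hrel e he z hz hu, MvPolynomial.eval_eq', Finset.sum_mul]
    apply Finset.sum_congr rfl
    intro d hd
    have hw := hψ (MvPolynomial.mem_support_iff.1 hd)
    rw [Finsupp.weight_apply, Finsupp.sum_fintype _ _ (by simp)] at hw
    change ∑ i : Fin 3, _ = _ at hw
    change _ * ∏ i : Fin 3, _ = _
    rw [Fin.sum_univ_three] at hw
    rw [Fin.prod_univ_three]
    simp at hw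
    -- The equation $2d_0+3d_1+4d_2=5$ has the unique solution $(1,1,0)$ in natural numbers.
    have h0 : d (0 : Fin 3) = 1 := by omega
    have h1 : d (1 : Fin 3) = 1 := by omega
    have h2 : d (2 : Fin 3) = 0 := by omega
    rw [h0, h1, h2]
    simp
    left
    ring

/-- The coefficient of a relation of degree five is determined by the vanishing order of the Hopf
differential at an umbilic point. -/
theorem HopfVanishesToOrder.relation_coefficient [IsManifold 𝓘(ℝ, ℂ) ∞ M] [OrientedAtlas M]
    (hX : IsMinimalImmersion X) {n : ℕ} {p : M}
    (hp : IsUmbilic X p) (hn : HopfVanishesToOrder X n p) {c : ℂ}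
    (hc : ∀ e : OpenPartialHomeomorph M ℂ, IsHolomorphicCoordinate X e →
      ∀ z ∈ e.target, ¬ IsUmbilic X (e.symm z) →
        entropy (X ∘ e.symm) 5 z =
          c * (entropy (X ∘ e.symm) 3 z * entropy (X ∘ e.symm) 2 z)) :
    n ≠ 0 ∧ c = -(24 * ((n : ℂ) + 2) ^ 2 / ((3 * (n : ℂ) + 4) * (n : ℂ))) := by
  obtain ⟨e, he, hpe, han, hord⟩ := hn
  have hz : e p ∈ e.target := e.map_source hpe
  have h0 : hopf (X ∘ e.symm) (e p) = 0 := by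
    rw [← he.isUmbilic_iff hX hz, e.left_inv hpe]
    exact hp
  have hn0 : n ≠ 0 := by
    rintro rfl
    exact han.analyticOrderAt_eq_zero.1 (by simpa using hord) h0
  refine ⟨hn0, (he.isOrientedChart.isMinimalPatch hX).relation_coefficient he.conformal hz hn0 hord
    fun w hw hq => hc e he w hw ?_⟩
  rwa [he.isUmbilic_iff hX hw]

end Surface

/-- Cross-multiplying, the difference factors as $m-n$ times $8mn+12(m+n)+16$, up to a constant, and
the second factor is positive. -/
theorem relation_coefficient_injective {m n : ℕ} (hm : m ≠ 0) (hn : n ≠ 0)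
    (h : 24 * ((m : ℂ) + 2) ^ 2 / ((3 * (m : ℂ) + 4) * (m : ℂ)) =
      24 * ((n : ℂ) + 2) ^ 2 / ((3 * (n : ℂ) + 4) * (n : ℂ))) : m = n := by
  have hne {k : ℕ} (hk : k ≠ 0) : (3 * (k : ℂ) + 4) * (k : ℂ) ≠ 0 := by
    exact_mod_cast mul_ne_zero (by omega : 3 * k + 4 ≠ 0) hk
  rw [div_eq_div_iff (hne hm) (hne hn)] at h
  have h1 : ((m : ℂ) - n) * (8 * m * n + 12 * (m + n) + 16) = 0 := by
    linear_combination -h / 24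
  have h2 : 8 * (m : ℂ) * n + 12 * (m + n) + 16 ≠ 0 := by
    exact_mod_cast (by omega : 8 * m * n + 12 * (m + n) + 16 ≠ 0)
  exact_mod_cast sub_eq_zero.1 ((mul_eq_zero.1 h1).resolve_right h2)

end EntropySurface

end

theorem mainTheorem4 {M : Type*} [TopologicalSpace M] [ConnectedSpace M] [ChartedSpace ℂ M]
    [IsManifold 𝓘(ℝ, ℂ) ∞ M] [EntropySurface.OrientedAtlas M]
    (X : M → EntropySurface.E3) (hX : EntropySurface.IsMinimalImmersion X)
    (hflat : EntropySurface.NonFlat X) (hdeg : EntropySurface.HasDegree X 5)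
    (n : ℕ) (p : M) (hp : EntropySurface.IsUmbilic X p)
    (hn : EntropySurface.HopfVanishesToOrder X n p) :
    (∀ q : M, EntropySurface.IsUmbilic X q → EntropySurface.HopfVanishesToOrder X n q) ∧
    (∀ e : OpenPartialHomeomorph M ℂ, EntropySurface.IsHolomorphicCoordinate X e →
      ∀ z ∈ e.target, ¬ EntropySurface.IsUmbilic X (e.symm z) →
        EntropySurface.entropy (X ∘ e.symm) 5 z +
          24 * ((n : ℂ) + 2) ^ 2 / ((3 * (n : ℂ) + 4) * (n : ℂ)) *
            (EntropySurface.entropy (X ∘ e.symm) 3 z *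
              EntropySurface.entropy (X ∘ e.symm) 2 z) = 0) := by
  obtain ⟨c, hc⟩ := hdeg.exists_coefficient
  obtain ⟨hn0, hcn⟩ := hn.relation_coefficient hX hp hc
  refine ⟨fun q hq => ?_, fun e he z hz hu => ?_⟩
  -- Some coordinate at $q$ gives a finite order $m$, and the shared constant $c$ forces $m=n$;
  -- independence of the order from the coordinate is never needed.
  · obtain ⟨m, hm⟩ := EntropySurface.exists_hopfVanishesToOrder hX hflat q
    obtain ⟨hm0, hcm⟩ := hm.relation_coefficient hX hq hc
    rwa [EntropySurface.relation_coefficient_injective hm0 hn0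
      (neg_injective (hcm.symm.trans hcn))] at hm
  · rw [hc e he z hz hu, hcn]
    ring
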